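/- A \emph{space of quasi-polynomials} is a complex vector space $V$ of functions on $\mathbb C$ spanned by functions $p_{ij}(x)e^{\lambda_i x}$, $i=1,\dots,n$, $j=1,\dots,N_i$, where $N_i\ge 1$, $\lambda_1,\dots,\lambda_n\in\mathbb C$ are distinct and, for each $i$, the $p_{ij}\in\mathbb C[x]$ satisfy $0<\deg p_{i1}<\dots<\deg p_{iN_i}$. Put $N=\dim V=N_1+\dots+N_n$. For $z\in\mathbb C$, the exponents of $V$ at $z$ are the orders at $z$ of the nonzero elements of $V$; $z$ is a singular point of $V$ if the set of exponents is not $\{0,\dots,N-1\}$. Let $z_1,\dots,z_m$ be the (finitely many) singular points of $V$. Let $\bar D_V$ be the unique monic linear differential operator of order $N$ with meromorphic coefficients annihilating $V$, and let $M_a$ be the smallest natural number such that all coefficients of $(x-z_a)^{M_a}\bar D_V$ have no pole at $z_a$. Let $\mathrm{Wr}_V$ be the Wronskian of a basis of $V$ (defined up to a nonzero constant factor), let $V^\star$ be the span of all functions $\mathrm{Wr}(f_1,\dots,f_{N-1})/\mathrm{Wr}_V$ with $f_1,\dots,f_{N-1}\in V$, and let $V^\dagger$ be the space of all functions $f\prod_{a=1}^m(x-z_a)^{-M_a}$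 with $f\in V^\star$. The space \emph{bispectral dual to} $V$ is the complex vector space $U$ spanned by the functions $$\hat f_a(u)=\int_{\gamma_a}e^{ux}f(x)\,dx,\qquad a=1,\dots,m,\quad f\in V^\dagger,$$ where $\gamma_a$ is a small circle around $z_a$ oriented counterclockwise. Let $V$ be a space of quasi-polynomials and let $U$ be the space bispectral dual to $V$. Then $U$ is a space of quasi-polynomials, and $V$ is the space bispectral dual to $U$. -/

import Mathlib

open scoped Topology Polynomial

noncomputable section

namespace Bispectral

/-- The Wronskian `Wr(f_1, …, f_k)`: the determinant of the matrix whose `j`-th row is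
`f_j, f_j', …, f_j^{(k-1)}`. -/
def wronskian {k : ℕ} (f : Fin k → ℂ → ℂ) (x : ℂ) : ℂ :=
  (Matrix.of fun j i : Fin k => iteratedDeriv (i : ℕ) (f j) x).det

/-- The determinant of the `k × k` matrix whose `j`-th row consists of the derivatives of `f_j` of
orders `0, …, k` with the order `p` omitted. -/
def wronskianOmit {k : ℕ} (f : Fin k → ℂ → ℂ) (p : Fin (k + 1)) (x : ℂ) : ℂ :=
  (Matrix.of fun j i : Fin k => iteratedDeriv (p.succAbove i : ℕ) (f j) x).det

/-- The coefficient of `∂_x^p` in the monic differential operator of order `k` that annihilates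
`f_1, …, f_k`. For `p = k` this is `Wr / Wr`, i.e. `1` off the zeros of the Wronskian. -/
def monicCoeff {k : ℕ} (f : Fin k → ℂ → ℂ) (p : Fin (k + 1)) (x : ℂ) : ℂ :=
  (-1) ^ (k - (p : ℕ)) * (wronskianOmit f p x / wronskian f x)

/-- The set of exponents of `V` at `z`: the orders at `z` of the nonzero elements of `V`
(the zero function has order `⊤`). -/
def exponents (V : Submodule ℂ (ℂ → ℂ)) (z : ℂ) : Set ℤ :=
  {e | ∃ f ∈ V, meromorphicOrderAt f z = (e : WithTop ℤ)}

/-- The points at which the set of exponents differs from `{0, …, N - 1}`, `N = dim V`. -/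
def singularPoints (V : Submodule ℂ (ℂ → ℂ)) : Set ℂ :=
  {z | exponents V z ≠ Set.Ico (0 : ℤ) (Module.finrank ℂ V : ℤ)}

/-- The smallest `k` such that all coefficients of `(x - z)^k D̄_V` have no pole at `z`, where
`D̄_V` is the monic fundamental operator of `V`. (`D̄_V` does not depend on the basis of `V` through
which its coefficients are written.) -/
def poleOrder (V : Submodule ℂ (ℂ → ℂ)) (z : ℂ) : ℕ :=
  sInf {k : ℕ | ∃ b : Module.Basis (Fin (Module.finrank ℂ V)) ℂ V,
    ∀ p, 0 ≤ meromorphicOrderAt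
      (fun x => (x - z) ^ k * monicCoeff (fun j => (b j : ℂ → ℂ)) p x) z}

/-- The leading coefficient `∏_a (x - z_a)^{M_a}` of the regularized fundamental operator of `V`;
the product is over the singular points of `V`. -/
def leadingCoeff (V : Submodule ℂ (ℂ → ℂ)) (x : ℂ) : ℂ :=
  ∏ᶠ z ∈ singularPoints V, (x - z) ^ poleOrder V z

/-- The conjugate space `V^⋆`, spanned by all `Wr(f_1, …, f_{N-1}) / Wr_V` with `f_i ∈ V`; here
`Wr_V` is the Wronskian of a basis of `V`, which is defined up to a nonzero constant factor. -/
def conjugate (V : Submodule ℂ (ℂ → ℂ)) : Submodule ℂ (ℂ → ℂ) :=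
  Submodule.span ℂ {g | ∃ b : Module.Basis (Fin (Module.finrank ℂ V)) ℂ V,
    ∃ k : ℕ, k + 1 = Module.finrank ℂ V ∧ ∃ f : Fin k → ℂ → ℂ, (∀ j, f j ∈ V) ∧
      g = fun x => wronskian f x / wronskian (fun j => (b j : ℂ → ℂ)) x}

/-- The regularized conjugate space `V^†`, spanned by all `f ∏_a (x - z_a)^{-M_a}`, `f ∈ V^⋆`. -/
def regularizedConjugate (V : Submodule ℂ (ℂ → ℂ)) : Submodule ℂ (ℂ → ℂ) :=
  Submodule.span ℂ {g | ∃ f ∈ conjugate V, g = fun x => f x * (leadingCoeff V x)⁻¹}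

/-- `g(u) = ∫_γ e^{ux} f(x) dx` for every sufficiently small counterclockwise circle `γ` around
`z`. -/
def IsIntegralTransform (f : ℂ → ℂ) (z : ℂ) (g : ℂ → ℂ) : Prop :=
  ∀ᶠ r : ℝ in 𝓝[>] 0, ∀ u : ℂ, g u = ∮ x in C(z, r), Complex.exp (u * x) * f x

/-- The space spanned by the integral transforms of the elements of `V^†` around the singular
points of `V`. -/
def transformSpace (V : Submodule ℂ (ℂ → ℂ)) : Submodule ℂ (ℂ → ℂ) :=
  Submodule.span ℂ {g | ∃ z ∈ singularPoints V, ∃ f ∈ regularizedConjugate V,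
    IsIntegralTransform f z g}

/-- `V` is a space of quasi-polynomials: it is spanned by functions `p_{ij}(x) e^{λ_i x}`,
`i = 1, …, n`, `j = 1, …, N_i`, where the `λ_i` are distinct complex numbers and the `p_{ij}` are
polynomials with `0 < deg p_{i1} < … < deg p_{iN_i}` for each `i`. -/
def IsQuasiPolynomialSpace (V : Submodule ℂ (ℂ → ℂ)) : Prop :=
  ∃ (n : ℕ) (N : Fin n → ℕ) (l : Fin n → ℂ) (p : (i : Fin n) → Fin (N i) → ℂ[X]),
    (∀ i, 0 < N i) ∧ Function.Injective l ∧
    (∀ i j, 0 < (p i j).natDegree) ∧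
    (∀ i, StrictMono fun j => (p i j).natDegree) ∧
    V = Submodule.span ℂ (Set.range fun (a : (i : Fin n) × Fin (N i)) =>
      fun x : ℂ => (p a.1 a.2).eval x * Complex.exp (l a.1 * x))

/-- `U` is bispectral dual to `V`. The notion is defined for spaces `V` of quasi-polynomials
only. -/
def IsBispectralDual (U V : Submodule ℂ (ℂ → ℂ)) : Prop :=
  IsQuasiPolynomialSpace V ∧ U = transformSpace V

end Bispectral

end

/-
After clearing denominators, the monic operator annihilating `V` becomes an operator
`L = ∑ a_{ij} x^i ∂^j` with polynomial coefficients whose leading coefficient is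
`∏ (x - z_a)^{M_a}`. Since `L e^{ux} = L(x, u) e^{ux}`, interchanging `x` and `∂` in `L` gives an
operator `L'` with `L' ∫_γ e^{ux} f(x) dx = ∫_γ (L e^{ux}) f(x) dx` for every `f`. For `f ∈ V^†`,
variation of parameters shows that the last integrand is the derivative of a function which is
single-valued near `z_a`, so that `U ⊆ ker L'`.

Let `s` be the least number which is not an exponent of `V` at `z_a`. Then `M_a` is the number of
exponents greater than `s`, and each such exponent `e` contributes to `U` an element
`q(u) e^{z_a u}` with `deg q = e - s > 0`. Hence `U` is a space of quasi-polynomials of dimension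
`∑ M_a`, which is the order of `L'`, and therefore `U = ker L'`. As `L'` is again regularized, the
same argument yields that the dual of `U` is the kernel of `(L')' = L`, which is `V`.
-/

noncomputable section

namespace Bispectral

open Polynomial

/-- The space of entire functions. -/
def entire : Submodule ℂ (ℂ → ℂ) where
  carrier := {f | Differentiable ℂ f}
  add_mem' hf hg := Differentiable.add hf hg
  zero_mem' := differentiable_const 0
  smul_mem' c _ hf := Differentiable.const_smul hf c

/-- The derivative, as an endomorphism of the space of entire functions. -/
def entireDeriv : Module.End ℂ entire where
  toFun f := ⟨deriv f, Differentiable.deriv f.2⟩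
  map_add' f g := Subtype.ext <| funext fun x => deriv_add (f.2 x) (g.2 x)
  map_smul' c f := Subtype.ext <| funext fun x => deriv_const_smul c (f.2 x)

/-- The quasi-polynomial `p(x) e^{l x}`. -/
def qexp (p : ℂ[X]) (l : ℂ) (x : ℂ) : ℂ := p.eval x * Complex.exp (l * x)

/-- The action of the derivative on the polynomial factor of `p(x) e^{l x}`. -/
def expDeriv (l : ℂ) (p : ℂ[X]) : ℂ[X] := derivative p + C l * p

lemma hasDerivAt_qexp (p : ℂ[X]) (l x : ℂ) :
    HasDerivAt (qexp p l) (qexp (expDeriv l p) l x) x := by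
  have hexp : HasDerivAt (fun x : ℂ => Complex.exp (l * x)) (Complex.exp (l * x) * l) x := by
    simpa using ((hasDerivAt_id x).const_mul l).cexp
  refine ((p.hasDerivAt x).mul hexp).congr_deriv ?_
  simp only [qexp, expDeriv, eval_add, eval_mul, eval_C]
  ring

lemma qexp_mem_entire (p : ℂ[X]) (l : ℂ) : qexp p l ∈ entire :=
  fun x => (hasDerivAt_qexp p l x).differentiableAt

lemma deriv_qexp (p : ℂ[X]) (l : ℂ) : deriv (qexp p l) = qexp (expDeriv l p) l :=
  funext fun x => (hasDerivAt_qexp p l x).deriv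

lemma iteratedDeriv_qexp (p : ℂ[X]) (l : ℂ) (k : ℕ) :
    iteratedDeriv k (qexp p l) = qexp ((expDeriv l)^[k] p) l := by
  induction k generalizing p with
  | zero => simp
  | succ k ih => rw [iteratedDeriv_succ', deriv_qexp, ih, Function.iterate_succ_apply]

lemma qexp_eq_zero_iff {p : ℂ[X]} {l : ℂ} : qexp p l = 0 ↔ p = 0 := by
  refine ⟨fun h => Polynomial.funext fun x => ?_, ?_⟩
  · simpa [qexp, Complex.exp_ne_zero] using congrFun h x
  · rintro rfl
    funext x
    simp [qexp]

lemma entireDeriv_sub_pow_qexp (p : ℂ[X]) (l : ℂ) (k : ℕ) :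
    ((entireDeriv - algebraMap ℂ _ l) ^ k) ⟨qexp p l, qexp_mem_entire p l⟩ =
      ⟨qexp (derivative^[k] p) l, qexp_mem_entire _ l⟩ := by
  induction k generalizing p with
  | zero => rfl
  | succ k ih =>
    have hstep : (entireDeriv - algebraMap ℂ _ l) ⟨qexp p l, qexp_mem_entire p l⟩ =
        ⟨qexp (derivative p) l, qexp_mem_entire _ l⟩ := by
      refine Subtype.ext <| funext fun x => ?_
      change deriv (qexp p l) x - l * qexp p l x = _
      rw [deriv_qexp]
      simp only [qexp, expDeriv, eval_add, eval_mul, eval_C]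
      ring
    rw [pow_succ, Module.End.mul_apply, hstep, ih, Function.iterate_succ_apply]

lemma qexp_mem_maxGenEigenspace (p : ℂ[X]) (l : ℂ) :
    ⟨qexp p l, qexp_mem_entire p l⟩ ∈ entireDeriv.maxGenEigenspace l := by
  refine (Module.End.mem_maxGenEigenspace _ _ _).2 ⟨p.natDegree + 1, ?_⟩
  rw [← Algebra.algebraMap_eq_smul_one, entireDeriv_sub_pow_qexp,
    iterate_derivative_eq_zero (Nat.lt_succ_self _)]
  exact Subtype.ext (qexp_eq_zero_iff.2 rfl)

lemma eq_zero_of_sum_qexp_eq_zero (S : Finset ℂ) (P : ℂ → ℂ[X])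
    (h : ∑ l ∈ S, qexp (P l) l = 0) : ∀ l ∈ S, P l = 0 := by
  intro l hl
  have hindep := (iSupIndep_iff_finsetSum_eq_zero_imp_eq_zero _).1
    entireDeriv.independent_maxGenEigenspace S
    (fun l => ⟨qexp (P l) l, qexp_mem_entire (P l) l⟩)
    (fun l _ => qexp_mem_maxGenEigenspace (P l) l)
    (Subtype.ext (by simpa using h)) l hl
  exact qexp_eq_zero_iff.1 (congrArg Subtype.val hindep)

lemma linearIndependent_of_natDegree_injective {ι K : Type*} [Field K] {q : ι → K[X]}
    (hq : ∀ a, q a ≠ 0) (hinj : Function.Injective fun a => (q a).natDegree) :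
    LinearIndependent K q := by
  rw [linearIndependent_iff']
  intro s c h a ha
  by_contra hca
  have hdeg : ∀ b, c b ≠ 0 → degree (c b • q b) = (q b).natDegree := fun b hb => by
    rw [smul_eq_C_mul, degree_C_mul hb, degree_eq_natDegree (hq b)]
  have hsup := degree_sum_eq_of_disjoint (fun b => c b • q b) s <| by
    rintro b ⟨-, hb⟩ b' ⟨-, hb'⟩ hbb' heq
    simp only [Function.comp_apply, hdeg _ (left_ne_zero_of_smul hb),
      hdeg _ (left_ne_zero_of_smul hb'), Nat.cast_inj] at heq
    exact hbb' (hinj heq)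
  have hle := Finset.le_sup (f := fun b => degree (c b • q b)) ha
  simp only [← hsup, h, degree_zero, hdeg a hca] at hle
  exact absurd hle (by simp)

/-- A family `q_a(x) e^{m_a x}` as in the definition of a space of quasi-polynomials, indexed by an
arbitrary type: the degrees are positive, and distinct for equal frequencies. -/
structure IsQuasiPolynomialFamily {ι : Type*} (q : ι → ℂ[X]) (m : ι → ℂ) : Prop where
  natDegree_pos : ∀ a, 0 < (q a).natDegree
  injective : Function.Injective fun a => (m a, (q a).natDegree)

lemma linearIndependent_qexp {ι : Type*} {q : ι → ℂ[X]} {m : ι → ℂ} (hq : ∀ a, q a ≠ 0)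
    (hinj : Function.Injective fun a => (m a, (q a).natDegree)) :
    LinearIndependent ℂ fun a => qexp (q a) (m a) := by
  classical
  rw [linearIndependent_iff']
  intro s c h a ha
  have hgroup : ∑ l ∈ s.image m, qexp (∑ b ∈ s with m b = l, c b • q b) l = 0 := by
    rw [← h, ← Finset.sum_fiberwise_of_maps_to (g := m) (t := s.image m)
      (fun b hb => Finset.mem_image_of_mem m hb)]
    refine Finset.sum_congr rfl fun l _ => funext fun x => ?_
    rw [Finset.sum_apply, qexp, eval_finsetSum, Finset.sum_mul]
    refine Finset.sum_congr rfl fun b hb => ?_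
    rw [← (Finset.mem_filter.1 hb).2]
    simp [qexp, mul_assoc]
  have hfiber : ∑ b ∈ s with m b = m a, c b • q b = 0 :=
    eq_zero_of_sum_qexp_eq_zero _ _ hgroup (m a) (Finset.mem_image_of_mem m ha)
  have hli := linearIndependent_of_natDegree_injective (q := fun b : {b // m b = m a} => q b)
    (fun b => hq b)
    (fun b b' hbb' => Subtype.ext (hinj (Prod.ext (b.2.trans b'.2.symm) hbb')))
  refine linearIndependent_iff'.1 hli (s.subtype fun b => m b = m a) (fun b => c b) ?_ ⟨a, rfl⟩
    (by simpa using ha)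
  rw [← hfiber]
  exact Finset.sum_subtype_eq_sum_filter fun b => c b • q b

lemma exists_sigma_fin_equiv {ι : Type*} [Finite ι] {m : ι → ℂ} {d : ι → ℕ}
    (hinj : Function.Injective fun a => (m a, d a)) :
    ∃ (n : ℕ) (N : Fin n → ℕ) (l : Fin n → ℂ) (e : ((i : Fin n) × Fin (N i)) ≃ ι),
      (∀ i, 0 < N i) ∧ Function.Injective l ∧ (∀ a, m (e a) = l a.1) ∧
      ∀ i, StrictMono fun j => d (e ⟨i, j⟩) := by
  classical
  have := Fintype.ofFinite ι
  have ε := Fintype.equivFin (Set.range m)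
  let k : ι → Fin (Fintype.card (Set.range m)) := ε ∘ Set.rangeFactorization m
  have hk : k.Surjective := ε.surjective.comp Set.rangeFactorization_surjective
  have hm : ∀ a, (ε.symm (k a) : ℂ) = m a := fun a => by simp [k]
  have hfiber : ∀ i, ∃ σ : Fin (Fintype.card {a // k a = i}) ≃ {a // k a = i},
      StrictMono fun j => d (σ j) := by
    intro i
    let _ : LinearOrder {a // k a = i} := LinearOrder.lift' (fun a => d a) fun a b hab =>
      Subtype.ext <| hinj <| Prod.ext (show m a = m b by rw [← hm a, ← hm b, a.2, b.2]) hab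
    exact ⟨(monoEquivOfFin _ rfl).toEquiv, (monoEquivOfFin {a // k a = i} rfl).strictMono⟩
  choose σ hσ using hfiber
  refine ⟨_, _, fun i => ε.symm i, (Equiv.sigmaCongrRight σ).trans (Equiv.sigmaFiberEquiv k),
    fun i => Fintype.card_pos_iff.2 ?_, Subtype.val_injective.comp ε.symm.injective, ?_, hσ⟩
  · obtain ⟨a, ha⟩ := hk i
    exact ⟨a, ha⟩
  · rintro ⟨i, j⟩
    change m (σ i j) = _
    rw [← hm, (σ i j).2]

lemma isQuasiPolynomialSpace_iff_exists_family {V : Submodule ℂ (ℂ → ℂ)} :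
    IsQuasiPolynomialSpace V ↔ ∃ (ι : Type) (_ : Fintype ι) (q : ι → ℂ[X]) (m : ι → ℂ),
      IsQuasiPolynomialFamily q m ∧
      V = Submodule.span ℂ (Set.range fun a => qexp (q a) (m a)) := by
  constructor
  · rintro ⟨n, N, l, p, -, hl, hp, hmono, rfl⟩
    refine ⟨(i : Fin n) × Fin (N i), inferInstance, fun a => p a.1 a.2, fun a => l a.1,
      ⟨fun a => hp _ _, ?_⟩, rfl⟩
    rintro ⟨i, j⟩ ⟨i', j'⟩ h
    obtain ⟨hi, hj⟩ := Prod.mk.inj h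
    obtain rfl := hl hi
    obtain rfl := (hmono i).injective hj
    rfl
  · rintro ⟨ι, _, q, m, hq, rfl⟩
    obtain ⟨n, N, l, e, hN, hl, hm, hmono⟩ := exists_sigma_fin_equiv hq.injective
    refine ⟨n, N, l, fun i j => q (e ⟨i, j⟩), hN, hl, fun i j => hq.natDegree_pos _, hmono, ?_⟩
    rw [← e.surjective.range_comp]
    simp only [Function.comp_def, hm]
    rfl

namespace IsQuasiPolynomialFamily

variable {ι : Type*} {q : ι → ℂ[X]} {m : ι → ℂ}

lemma ne_zero (h : IsQuasiPolynomialFamily q m) (a : ι) : q a ≠ 0 :=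
  ne_zero_of_natDegree_gt (h.natDegree_pos a)

lemma finrank_span [Fintype ι] (h : IsQuasiPolynomialFamily q m) :
    Module.finrank ℂ (Submodule.span ℂ (Set.range fun a => qexp (q a) (m a))) =
      Fintype.card ι :=
  finrank_span_eq_card (linearIndependent_qexp h.ne_zero h.injective)

lemma exp_notMem_span (h : IsQuasiPolynomialFamily q m) (μ : ℂ) :
    qexp 1 μ ∉ Submodule.span ℂ (Set.range fun a => qexp (q a) (m a)) := by
  have hli : LinearIndependent ℂ
      fun o : Option ι => qexp (o.elim 1 q : ℂ[X]) (o.elim μ m) := by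
    refine linearIndependent_qexp ?_ ?_
    · rintro (_ | a)
      exacts [one_ne_zero, h.ne_zero a]
    · rintro (_ | a) (_ | b) hab
      · rfl
      · exact absurd (congrArg Prod.snd hab) (by simpa using (h.natDegree_pos b).ne)
      · exact absurd (congrArg Prod.snd hab) (by simpa using (h.natDegree_pos a).ne')
      · exact congrArg some (h.injective hab)
  exact (linearIndependent_option.1 hli).2

end IsQuasiPolynomialFamily

lemma differentiable_iteratedDeriv {f : ℂ → ℂ} (hf : Differentiable ℂ f) (k : ℕ) :
    Differentiable ℂ (iteratedDeriv k f) :=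
  (hf.contDiff (n := ⊤)).differentiable_iteratedDeriv k (WithTop.coe_lt_top _)

lemma hasDerivAt_iteratedDeriv {f : ℂ → ℂ} (hf : Differentiable ℂ f) (k : ℕ) (x : ℂ) :
    HasDerivAt (iteratedDeriv k f) (iteratedDeriv (k + 1) f x) x := by
  rw [iteratedDeriv_succ]
  exact (differentiable_iteratedDeriv hf k x).hasDerivAt

/-- The differential operator `∑ A_p(x) ∂^p` applied to `f`; the operator is encoded as the
polynomial `L = ∑ A_p X^p`, so that `X` stands for `∂` and the coefficients are on the left. -/
def diffOp (L : ℂ[X][X]) (f : ℂ → ℂ) (x : ℂ) : ℂ :=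
  L.sum fun p a => a.eval x * iteratedDeriv p f x

section diffOp

variable (L K : ℂ[X][X]) (f : ℂ → ℂ)

lemma diffOp_eq_sum_range {n : ℕ} (hn : L.natDegree < n) (x : ℂ) :
    diffOp L f x = ∑ p ∈ Finset.range n, (L.coeff p).eval x * iteratedDeriv p f x :=
  sum_over_range' L (fun _ => by simp) n hn

lemma diffOp_monomial (p : ℕ) (a : ℂ[X]) (x : ℂ) :
    diffOp (monomial p a) f x = a.eval x * iteratedDeriv p f x :=
  sum_monomial_index _ _ (by simp)

lemma diffOp_add_left (x : ℂ) : diffOp (L + K) f x = diffOp L f x + diffOp K f x :=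
  sum_add_index _ _ _ (fun _ => by simp) fun _ _ _ => by rw [eval_add, add_mul]

lemma diffOp_C_mul (a : ℂ[X]) (x : ℂ) : diffOp (C a * L) f x = a.eval x * diffOp L f x := by
  rw [diffOp_eq_sum_range _ _ (Nat.lt_succ_of_le (natDegree_C_mul_le a L)),
    diffOp_eq_sum_range L f L.natDegree.lt_succ_self, Finset.mul_sum]
  simp only [coeff_C_mul, eval_mul, mul_assoc]

lemma diffOp_sub_left (x : ℂ) : diffOp (L - K) f x = diffOp L f x - diffOp K f x := by
  rw [eq_sub_iff_add_eq, ← diffOp_add_left, sub_add_cancel]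

variable {f}

lemma diffOp_add {g : ℂ → ℂ} (hf : Differentiable ℂ f) (hg : Differentiable ℂ g) (x : ℂ) :
    diffOp L (f + g) x = diffOp L f x + diffOp L g x := by
  simp only [diffOp, Polynomial.sum, ← Finset.sum_add_distrib]
  refine Finset.sum_congr rfl fun p _ => ?_
  rw [iteratedDeriv_add hf.contDiff.contDiffAt hg.contDiff.contDiffAt, mul_add]

lemma diffOp_smul (c : ℂ) (f : ℂ → ℂ) (x : ℂ) : diffOp L (c • f) x = c * diffOp L f x := by
  simp only [diffOp, Polynomial.sum, Finset.mul_sum]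
  refine Finset.sum_congr rfl fun p _ => ?_
  rw [iteratedDeriv_const_smul_field, smul_eq_mul]
  ring

lemma differentiable_diffOp (hf : Differentiable ℂ f) : Differentiable ℂ (diffOp L f) :=
  Differentiable.fun_sum fun p _ =>
    (L.coeff p).differentiable.mul (differentiable_iteratedDeriv hf p)

lemma diffOp_exp (u x : ℂ) :
    diffOp L (fun x => Complex.exp (u * x)) x = L.evalEval x u * Complex.exp (u * x) := by
  rw [← eval₂_evalRingHom, eval₂_eq_sum, diffOp, sum_def, sum_def, Finset.sum_mul]
  simp [iteratedDeriv_cexp_const_mul, mul_assoc]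

/-- The composition `∂ ∘ L`. -/
def derivComp (L : ℂ[X][X]) : ℂ[X][X] :=
  (L.sum fun p a => monomial p (derivative a)) + X * L

lemma coeff_derivComp (n : ℕ) :
    (derivComp L).coeff n = derivative (L.coeff n) + (X * L).coeff n := by
  rw [derivComp, coeff_add, sum_def, finsetSum_coeff]
  simp only [coeff_monomial, Finset.sum_ite_eq', mem_support_iff]
  split_ifs with h
  · rfl
  · rw [not_not.1 h, derivative_zero]

lemma deriv_diffOp (hf : Differentiable ℂ f) : deriv (diffOp L f) = diffOp (derivComp L) f := by
  induction L using Polynomial.induction_on' with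
  | add L K hL hK =>
    have hadd : derivComp (L + K) = derivComp L + derivComp K := by
      ext1 n
      simp only [coeff_derivComp, coeff_add, mul_add, derivative_add]
      ring
    funext x
    rw [hadd, diffOp_add_left, ← hL, ← hK, funext (diffOp_add_left L K f)]
    exact deriv_fun_add (differentiable_diffOp L hf x) (differentiable_diffOp K hf x)
  | monomial p a =>
    funext x
    rw [derivComp, sum_monomial_index _ _ (by simp), X_mul_monomial, diffOp_add_left,
      diffOp_monomial, diffOp_monomial, funext (diffOp_monomial f p a)]
    exact ((a.hasDerivAt x).mul (hasDerivAt_iteratedDeriv hf p x)).deriv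

end diffOp

/-- The space of entire solutions of `L f = 0`. -/
def entireKer (L : ℂ[X][X]) : Submodule ℂ (ℂ → ℂ) where
  carrier := {f | Differentiable ℂ f ∧ ∀ x, diffOp L f x = 0}
  add_mem' {f g} hf hg :=
    ⟨hf.1.add hg.1, fun x => by rw [diffOp_add L hf.1 hg.1, hf.2, hg.2, add_zero]⟩
  zero_mem' := ⟨differentiable_const 0, fun x => by simp [diffOp, Polynomial.sum]⟩
  smul_mem' c f hf := ⟨hf.1.const_smul c, fun x => by rw [diffOp_smul, hf.2, mul_zero]⟩

lemma entireKer_le_entire (L : ℂ[X][X]) : entireKer L ≤ entire := fun _ hf => hf.1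

lemma coeff_coeff_swap {R : Type*} [CommRing R] (L : R[X][X]) (i j : ℕ) :
    ((Bivariate.swap L).coeff i).coeff j = (L.coeff j).coeff i := by
  induction L using Polynomial.induction_on' with
  | add L K hL hK => simp only [map_add, coeff_add, hL, hK]
  | monomial p a =>
    induction a using Polynomial.induction_on' with
    | add a b ha hb => simp only [map_add, coeff_add, ha, hb]
    | monomial q r =>
      simp only [Bivariate.swap_monomial_monomial, coeff_monomial]
      split_ifs <;> simp_all [coeff_monomial]

lemma evalEval_swap {R : Type*} [CommRing R] (L : R[X][X]) (x y : R) :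
    (Bivariate.swap L).evalEval x y = L.evalEval y x := by
  simpa only [coe_aevalAeval_eq_evalEval] using Bivariate.aevalAeval_swap x y L

lemma analyticOrderAt_ne_top_of_differentiable {f : ℂ → ℂ} (hf : Differentiable ℂ f) (hne : f ≠ 0)
    (z : ℂ) : analyticOrderAt f z ≠ ⊤ := fun h =>
  hne <| AnalyticOnNhd.eq_of_eventuallyEq (z₀ := z) (fun x _ => hf.analyticAt x)
    (fun _ _ => analyticAt_const) (analyticOrderAt_eq_top.1 h)

lemma iteratedDeriv_eq_zero_of_lt_analyticOrderAt {f : ℂ → ℂ} (hf : Differentiable ℂ f) {z : ℂ}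
    {n p : ℕ} (hn : analyticOrderAt f z = n) (hp : p < n) : iteratedDeriv p f z = 0 :=
  ((analyticOrderAt_eq_nat_iff_iteratedDeriv_eq_zero (hf.analyticAt z)).1 hn).1 p hp

lemma iteratedDeriv_analyticOrderAt_ne_zero {f : ℂ → ℂ} (hf : Differentiable ℂ f) {z : ℂ}
    {n : ℕ} (hn : analyticOrderAt f z = n) : iteratedDeriv n f z ≠ 0 :=
  ((analyticOrderAt_eq_nat_iff_iteratedDeriv_eq_zero (hf.analyticAt z)).1 hn).2

lemma pow_mul_deriv_eventuallyEq {F G : ℂ → ℂ} {z : ℂ} {k e : ℕ} (hF : Differentiable ℂ F)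
    (hG : AnalyticAt ℂ G z) (h : ∀ᶠ x in 𝓝 z, (x - z) ^ k * F x = (x - z) ^ e * G x) :
    ∀ᶠ x in 𝓝 z, (x - z) ^ (k + 1) * deriv F x =
      (x - z) ^ e * ((x - z) * deriv G x + ((e : ℂ) - k) * G x) := by
  have hpow : ∀ (n : ℕ) (x : ℂ),
      HasDerivAt (fun x : ℂ => (x - z) ^ n) (n * (x - z) ^ (n - 1)) x := fun n x => by
    simpa using ((hasDerivAt_id x).sub_const z).fun_pow n
  have hpow_pred : ∀ (n : ℕ) (x : ℂ), (n : ℂ) * (x - z) ^ (n - 1) * (x - z) = n * (x - z) ^ n := by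
    rintro (_ | n) x
    · simp
    · rw [Nat.add_sub_cancel, pow_succ, mul_assoc]
  filter_upwards [Filter.EventuallyEq.deriv h, h, hG.eventually_analyticAt] with x hderiv hx hGx
  rw [((hpow k x).fun_mul (hF x).hasDerivAt).deriv,
    ((hpow e x).fun_mul hGx.differentiableAt.hasDerivAt).deriv] at hderiv
  linear_combination (x - z) * hderiv - k * hx - F x * hpow_pred k x + G x * hpow_pred e x

lemma exists_pow_mul_iteratedDeriv_eventuallyEq {f : ℂ → ℂ} (hf : Differentiable ℂ f) {z : ℂ}
    {e : ℕ} (he : analyticOrderAt f z = e) :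
    ∃ c : ℂ, c ≠ 0 ∧ ∀ k, ∃ G : ℂ → ℂ, AnalyticAt ℂ G z ∧
      G z = c * (descPochhammer ℂ k).eval (e : ℂ) ∧
      ∀ᶠ x in 𝓝 z, (x - z) ^ k * iteratedDeriv k f x = (x - z) ^ e * G x := by
  obtain ⟨h, hh, hz, hfh⟩ := ((hf.analyticAt z).analyticOrderAt_eq_natCast).1 he
  refine ⟨h z, hz, fun k => ?_⟩
  induction k with
  | zero => exact ⟨h, hh, by simp, by simpa using hfh⟩
  | succ k ih =>
    obtain ⟨G, hG, hGz, hGf⟩ := ih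
    have := hG.deriv
    refine ⟨fun x => (x - z) * deriv G x + ((e : ℂ) - k) * G x, by fun_prop, ?_, ?_⟩
    · rw [descPochhammer_succ_eval, ← mul_assoc, ← hGz]
      ring
    · rw [iteratedDeriv_succ]
      exact pow_mul_deriv_eventuallyEq (differentiable_iteratedDeriv hf k) hG hGf

/-- The indicial polynomial `∑ c_p t (t - 1) ⋯ (t - p + 1)` of the Euler operator
`∑ c_p (x - z)^p ∂^p`, which is encoded as the polynomial `P = ∑ c_p X^p`. -/
def indicial (P : ℂ[X]) : ℂ[X] := P.sum fun p c => c • descPochhammer ℂ p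

lemma natDegree_indicial_le (P : ℂ[X]) : (indicial P).natDegree ≤ P.natDegree :=
  natDegree_sum_le_of_forall_le _ _ fun p hp => (natDegree_smul_le _ _).trans <| by
    rw [descPochhammer_natDegree]
    exact le_natDegree_of_mem_supp p hp

lemma indicial_ne_zero {P : ℂ[X]} (hP : P ≠ 0) : indicial P ≠ 0 := by
  have hli : LinearIndependent ℂ (descPochhammer ℂ) :=
    linearIndependent_of_natDegree_injective (fun p => (monic_descPochhammer ℂ p).ne_zero)
      fun p p' h => by simpa only [descPochhammer_natDegree] using h
  exact fun h => leadingCoeff_ne_zero.2 hP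
    (linearIndependent_iff'.1 hli _ _ h _ (natDegree_mem_support_of_nonzero hP))

lemma eval_indicial {P : ℂ[X]} {n : ℕ} (hn : P.natDegree < n) (t : ℂ) :
    (indicial P).eval t = ∑ p ∈ Finset.range n, P.coeff p * (descPochhammer ℂ p).eval t := by
  rw [indicial, sum_over_range' _ (fun p => zero_smul ℂ (descPochhammer ℂ p)) n hn,
    eval_finsetSum]
  simp only [eval_smul, smul_eq_mul]

lemma natDegree_eq_of_scaleRoots_eq {R : Type*} [CommRing R] [IsDomain R] {L E : R[X]} {a y : R}
    (ha : a ≠ 0) (hE : L.scaleRoots y = C a * E) : E.natDegree = L.natDegree := by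
  rw [← natDegree_C_mul ha, ← hE, natDegree_scaleRoots]

lemma coeff_mul_pow_eq_of_scaleRoots_eq {R : Type*} [CommSemiring R] {L E : R[X]} {a y : R}
    (hE : L.scaleRoots y = C a * E) (p : ℕ) :
    L.coeff p * y ^ (L.natDegree - p) = E.coeff p * a := by
  simpa only [coeff_scaleRoots, coeff_C_mul, mul_comm a] using congrArg (fun P => P.coeff p) hE

/-- Here `hE` encodes `(x - z)^N L = (x - z)^k ∑ E_p(x) (x - z)^p ∂^p`, where `N` is the order of
`L`. -/
lemma indicial_eval_analyticOrderAt_eq_zero {L E : ℂ[X][X]} {z : ℂ} {k : ℕ}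
    (hE : L.scaleRoots (X - C z) = C ((X - C z) ^ k) * E) {f : ℂ → ℂ} (hf : f ∈ entireKer L)
    {e : ℕ} (he : analyticOrderAt f z = e) :
    (indicial (E.map (evalRingHom z))).eval (e : ℂ) = 0 := by
  set N := L.natDegree
  have hEN : E.natDegree = N :=
    natDegree_eq_of_scaleRoots_eq (pow_ne_zero k (X_sub_C_ne_zero z)) hE
  obtain ⟨c, hc, hG⟩ := exists_pow_mul_iteratedDeriv_eventuallyEq hf.1 he
  choose G hG hGz hGf using hG
  have hcoeff : ∀ (p : ℕ) (x : ℂ), (L.coeff p).eval x * (x - z) ^ (N - p) =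
      (E.coeff p).eval x * (x - z) ^ k := fun p x => by
    simpa only [eval_mul, eval_pow, eval_sub, eval_X, eval_C]
      using congrArg (eval x) (coeff_mul_pow_eq_of_scaleRoots_eq hE p)
  have hprod : ∀ᶠ x in 𝓝 z,
      (x - z) ^ (k + e) * ∑ p ∈ Finset.range (N + 1), (E.coeff p).eval x * G p x = 0 := by
    filter_upwards [(Finset.eventually_all (Finset.range (N + 1))).2 fun p _ => hGf p] with x hx
    have hLf := congrArg ((x - z) ^ N * ·) (hf.2 x)
    simp only [diffOp_eq_sum_range L f N.lt_succ_self, mul_zero] at hLf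
    rw [← hLf, Finset.mul_sum, Finset.mul_sum]
    refine Finset.sum_congr rfl fun p hp => ?_
    have hpow : (x - z) ^ N = (x - z) ^ (N - p) * (x - z) ^ p := by
      rw [← pow_add, Nat.sub_add_cancel (Finset.mem_range_succ_iff.1 hp)]
    rw [hpow, pow_add]
    linear_combination (-(x - z) ^ k * (E.coeff p).eval x) * hx p hp
      - (x - z) ^ p * iteratedDeriv p f x * hcoeff p x
  have hsum : AnalyticAt ℂ
      (fun x => ∑ p ∈ Finset.range (N + 1), (E.coeff p).eval x * G p x) z :=
    Finset.analyticAt_fun_sum _ fun p _ =>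
      ((E.coeff p).differentiable.analyticAt z).mul (hG p)
  have hz : ∑ p ∈ Finset.range (N + 1), (E.coeff p).eval z * G p z = 0 := by
    refine (hsum.frequently_zero_iff_eventually_zero.1 ?_).self_of_nhds
    refine Filter.Eventually.frequently ?_
    filter_upwards [hprod.filter_mono nhdsWithin_le_nhds, self_mem_nhdsWithin] with x hx hne
    exact (mul_eq_zero.1 hx).resolve_left (pow_ne_zero _ (sub_ne_zero.2 hne))
  rw [eval_indicial (n := N + 1) (natDegree_map_le.trans_lt (by omega))]
  refine (mul_eq_zero.1 ?_).resolve_left hc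
  simp only [coeff_map, coe_evalRingHom, Finset.mul_sum, ← hz, hGz]
  exact Finset.sum_congr rfl fun p _ => by ring

/-- The linear map sending a function to its derivatives of orders `k i` at `z`. -/
def jet {V : Submodule ℂ (ℂ → ℂ)} (hV : V ≤ entire) (z : ℂ) {ι : Type*} (k : ι → ℕ) :
    V →ₗ[ℂ] (ι → ℂ) where
  toFun f i := iteratedDeriv (k i) (f : ℂ → ℂ) z
  map_add' f g := funext fun _ => iteratedDeriv_add
    (Differentiable.contDiff (hV f.2)).contDiffAt (Differentiable.contDiff (hV g.2)).contDiffAt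
  map_smul' c f := funext fun _ => iteratedDeriv_const_smul_field c (f : ℂ → ℂ)

lemma jet_injective {V : Submodule ℂ (ℂ → ℂ)} (hV : V ≤ entire) {z : ℂ} {ι : Type*} {k : ι → ℕ}
    (hk : ∀ f ∈ V, ∀ n : ℕ, analyticOrderAt f z = n → n ∈ Set.range k) :
    Function.Injective (jet hV z k) := by
  rw [← LinearMap.ker_eq_bot, LinearMap.ker_eq_bot']
  intro f hf
  by_contra hne
  obtain ⟨n, hn⟩ := WithTop.ne_top_iff_exists.1
    (analyticOrderAt_ne_top_of_differentiable (hV f.2) (fun h => hne (Subtype.ext h)) z)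
  obtain ⟨i, rfl⟩ := hk f f.2 n hn.symm
  exact iteratedDeriv_analyticOrderAt_ne_zero (hV f.2) hn.symm (congrFun hf i)

lemma exists_eval_ne_zero {p : ℂ[X]} (hp : p ≠ 0) : ∃ z, p.eval z ≠ 0 := by
  by_contra! h
  exact hp (Polynomial.funext (by simpa using h))

lemma analyticOrderAt_lt_natDegree {L : ℂ[X][X]} {z : ℂ} (hz : L.leadingCoeff.eval z ≠ 0)
    {f : ℂ → ℂ} (hf : f ∈ entireKer L) {e : ℕ} (he : analyticOrderAt f z = e) :
    e < L.natDegree := by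
  have hroot := indicial_eval_analyticOrderAt_eq_zero (E := L.scaleRoots (X - C z)) (k := 0)
    (by simp) hf he
  rw [eval_indicial (n := L.natDegree + 1)
      (natDegree_map_le.trans_lt (by rw [natDegree_scaleRoots]; exact Nat.lt_succ_self _)),
    Finset.sum_range_succ, Finset.sum_eq_zero, zero_add] at hroot
  · simpa [hz, descPochhammer_eval_eq_descFactorial] using hroot
  · intro p hp
    simp [(Nat.sub_pos_of_lt (Finset.mem_range.1 hp)).ne']

lemma finrank_entireKer_le {L : ℂ[X][X]} (hL : L ≠ 0) :
    FiniteDimensional ℂ (entireKer L) ∧ Module.finrank ℂ (entireKer L) ≤ L.natDegree := by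
  obtain ⟨z, hz⟩ := exists_eval_ne_zero (leadingCoeff_ne_zero.2 hL)
  have hinj : Function.Injective
      (jet (entireKer_le_entire L) z fun i : Fin L.natDegree => (i : ℕ)) :=
    jet_injective _ fun f hf n hn => ⟨⟨n, analyticOrderAt_lt_natDegree hz hf hn⟩, rfl⟩
  exact ⟨FiniteDimensional.of_injective _ hinj,
    by simpa using LinearMap.finrank_le_finrank_of_injective hinj⟩

lemma eq_entireKer_of_natDegree_le_finrank {L : ℂ[X][X]} (hL : L ≠ 0)
    {V : Submodule ℂ (ℂ → ℂ)} (hV : V ≤ entireKer L) (hr : L.natDegree ≤ Module.finrank ℂ V) :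
    V = entireKer L := by
  obtain ⟨_, hle⟩ := finrank_entireKer_le hL
  exact Submodule.eq_of_le_of_finrank_le hV (hle.trans hr)

/-- `L` is a regularized fundamental operator, that of the space of entire solutions of `L f = 0`:
this space has the dimension `L.natDegree`, and the coefficients of `L` are polynomials without
common zeros, of degree at most that of the leading one, which is monic. -/
structure IsRegular (L : ℂ[X][X]) : Prop where
  finrank_entireKer : Module.finrank ℂ (entireKer L) = L.natDegree
  monic_leadingCoeff : L.leadingCoeff.Monic
  natDegree_coeff_le : ∀ p, (L.coeff p).natDegree ≤ L.leadingCoeff.natDegree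
  map_eval_ne_zero : ∀ z, L.map (evalRingHom z) ≠ 0

lemma IsRegular.ne_zero {L : ℂ[X][X]} (hL : IsRegular L) : L ≠ 0 :=
  leadingCoeff_ne_zero.1 hL.monic_leadingCoeff.ne_zero

lemma IsRegular.finiteDimensional {L : ℂ[X][X]} (hL : IsRegular L) :
    FiniteDimensional ℂ (entireKer L) :=
  (finrank_entireKer_le hL.ne_zero).1

lemma diffOp_qexp (L : ℂ[X][X]) (q : ℂ[X]) (l : ℂ) :
    ∃ r : ℂ[X], diffOp L (qexp q l) = qexp r l := by
  refine ⟨L.sum fun p a => a * (expDeriv l)^[p] q, funext fun x => ?_⟩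
  simp only [diffOp, qexp, Polynomial.sum, iteratedDeriv_qexp, eval_finsetSum, eval_mul,
    Finset.sum_mul, mul_assoc]

lemma exists_firstOrder_annihilator (r : ℂ[X]) (l : ℂ) :
    ∃ p g : ℂ[X], p ≠ 0 ∧ g.natDegree ≤ p.natDegree ∧
      ∀ x, p.eval x * deriv (qexp r l) x - g.eval x * qexp r l x = 0 := by
  obtain ⟨p, hp, hpr⟩ : ∃ p : ℂ[X], p ≠ 0 ∧ p * expDeriv l r - expDeriv l p * r = 0 := by
    rcases eq_or_ne r 0 with rfl | hr
    · exact ⟨1, one_ne_zero, by simp [expDeriv]⟩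
    · exact ⟨r, hr, by ring⟩
  refine ⟨p, expDeriv l p, hp, natDegree_add_le_of_degree_le
    ((natDegree_derivative_le p).trans (Nat.sub_le _ 1)) (natDegree_C_mul_le l p), fun x => ?_⟩
  have h := congrArg (fun s => eval x s * Complex.exp (l * x)) hpr
  simp only [eval_sub, eval_mul, eval_zero, zero_mul] at h
  rw [deriv_qexp, qexp, qexp, ← h]
  ring

/-- The composition `(p ∂ - g) ∘ L`. -/
def firstOrderComp (p g : ℂ[X]) (L : ℂ[X][X]) : ℂ[X][X] := C p * derivComp L - C g * L

section firstOrderComp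

variable (p g : ℂ[X]) (L : ℂ[X][X])

lemma diffOp_firstOrderComp {f : ℂ → ℂ} (hf : Differentiable ℂ f) (x : ℂ) :
    diffOp (firstOrderComp p g L) f x =
      p.eval x * deriv (diffOp L f) x - g.eval x * diffOp L f x := by
  rw [firstOrderComp, diffOp_sub_left, diffOp_C_mul, diffOp_C_mul, deriv_diffOp L hf]

lemma coeff_firstOrderComp (n : ℕ) :
    (firstOrderComp p g L).coeff n =
      p * (derivative (L.coeff n) + (X * L).coeff n) - g * L.coeff n := by
  rw [firstOrderComp, coeff_sub, coeff_C_mul, coeff_C_mul, coeff_derivComp]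

variable {p L}

lemma natDegree_firstOrderComp (hp : p ≠ 0) (hL : L ≠ 0) :
    (firstOrderComp p g L).natDegree = L.natDegree + 1 := by
  refine natDegree_eq_of_le_of_coeff_ne_zero (natDegree_le_iff_coeff_eq_zero.2 fun n hn => ?_) ?_
  · obtain ⟨n, rfl⟩ := Nat.exists_eq_add_of_lt hn
    rw [coeff_firstOrderComp, coeff_X_mul, coeff_eq_zero_of_natDegree_lt (by omega),
      coeff_eq_zero_of_natDegree_lt (by omega)]
    simp
  · rw [coeff_firstOrderComp, coeff_eq_zero_of_natDegree_lt L.natDegree.lt_succ_self, coeff_X_mul]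
    simpa using ⟨hp, hL⟩

lemma leadingCoeff_firstOrderComp (hp : p ≠ 0) (hL : L ≠ 0) :
    (firstOrderComp p g L).leadingCoeff = p * L.leadingCoeff := by
  rw [Polynomial.leadingCoeff, natDegree_firstOrderComp g hp hL, coeff_firstOrderComp,
    coeff_eq_zero_of_natDegree_lt L.natDegree.lt_succ_self, coeff_X_mul]
  simp

variable {g}

lemma natDegree_coeff_firstOrderComp_le (hg : g.natDegree ≤ p.natDegree) {d : ℕ}
    (hL : ∀ n, (L.coeff n).natDegree ≤ d) (n : ℕ) :
    ((firstOrderComp p g L).coeff n).natDegree ≤ p.natDegree + d := by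
  have hXL : ((X * L).coeff n).natDegree ≤ d := by
    cases n with
    | zero => simp
    | succ n => simpa using hL n
  rw [coeff_firstOrderComp]
  refine (natDegree_sub_le _ _).trans (max_le (natDegree_mul_le_of_le le_rfl ?_)
    (natDegree_mul_le_of_le hg (hL n)))
  exact natDegree_add_le_of_degree_le
    ((natDegree_derivative_le _).trans ((Nat.sub_le _ 1).trans (hL n))) hXL

end firstOrderComp

lemma exists_annihilator {ι : Type*} (S : Finset ι) (q : ι → ℂ[X]) (m : ι → ℂ) :
    ∃ L : ℂ[X][X], L ≠ 0 ∧ L.natDegree = S.card ∧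
      (∀ n, (L.coeff n).natDegree ≤ L.leadingCoeff.natDegree) ∧
      ∀ a ∈ S, qexp (q a) (m a) ∈ entireKer L := by
  classical
  induction S using Finset.induction_on with
  | empty =>
    refine ⟨1, one_ne_zero, by simp, fun n => ?_, by simp⟩
    rw [coeff_one]
    split_ifs <;> simp
  | insert a S ha ih =>
    obtain ⟨L, hL0, hLS, hdeg, hL⟩ := ih
    obtain ⟨r, hr⟩ := diffOp_qexp L (q a) (m a)
    obtain ⟨p, g, hp, hg, hpg⟩ := exists_firstOrder_annihilator r (m a)
    refine ⟨firstOrderComp p g L, ?_, ?_, ?_, ?_⟩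
    · refine ne_zero_of_natDegree_gt (n := L.natDegree) ?_
      rw [natDegree_firstOrderComp g hp hL0]
      exact L.natDegree.lt_succ_self
    · rw [natDegree_firstOrderComp g hp hL0, hLS, Finset.card_insert_of_notMem ha]
    · rw [leadingCoeff_firstOrderComp g hp hL0, natDegree_mul hp (leadingCoeff_ne_zero.2 hL0)]
      exact natDegree_coeff_firstOrderComp_le hg hdeg
    · intro b hb
      refine ⟨qexp_mem_entire _ _, fun x => ?_⟩
      rw [diffOp_firstOrderComp p g L (qexp_mem_entire _ _)]
      rcases Finset.mem_insert.1 hb with rfl | hb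
      · rw [hr, hpg]
      · rw [funext (hL b hb).2]
        simp

lemma entireKer_C_mul {a : ℂ[X]} (ha : a ≠ 0) (L : ℂ[X][X]) :
    entireKer (C a * L) = entireKer L := by
  ext f
  refine and_congr_right fun hf => ⟨fun h => congrFun ?_, fun h x => ?_⟩
  · refine Continuous.ext_on (f := diffOp L f) (g := 0)
      ((a.rootSet ℂ).toFinite.countable.dense_compl ℂ)
      (differentiable_diffOp L hf).continuous continuous_zero fun x hx => ?_
    refine (mul_eq_zero.1 ((diffOp_C_mul L f a x).symm.trans (h x))).resolve_left fun hax => hx ?_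
    exact (mem_rootSet_of_ne ha).2 (by simpa using hax)
  · rw [diffOp_C_mul, h, mul_zero]

lemma exists_eq_C_mul_of_map_eval_ne_zero {L : ℂ[X][X]} (hL : L ≠ 0) :
    ∃ (a : ℂ[X]) (K : ℂ[X][X]), a ≠ 0 ∧ L = C a * K ∧ K.leadingCoeff.Monic ∧
      ∀ z, K.map (evalRingHom z) ≠ 0 := by
  let _ : NormalizedGCDMonoid ℂ[X] := Classical.choice inferInstance
  set c := L.primPart.leadingCoeff.leadingCoeff
  have hc : c ≠ 0 := leadingCoeff_ne_zero.2 (leadingCoeff_ne_zero.2 L.isPrimitive_primPart.ne_zero)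
  refine ⟨L.content * C c, C (C c⁻¹) * L.primPart, ?_, ?_, ?_, fun z hz => ?_⟩
  · exact mul_ne_zero (content_eq_zero_iff.not.2 hL) (C_ne_zero.2 hc)
  · rw [C_mul, mul_assoc, ← mul_assoc (C (C c)), ← C_mul, ← C_mul, mul_inv_cancel₀ hc]
    simpa using L.eq_C_content_mul_primPart
  · rw [Polynomial.leadingCoeff_mul, leadingCoeff_C]
    exact monic_C_mul_of_mul_leadingCoeff_eq_one (inv_mul_cancel₀ hc)
  · refine not_isUnit_X_sub_C z (L.isPrimitive_primPart _
      ((C_dvd_iff_dvd_coeff _ _).2 fun n => ?_))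
    have hn := congrArg (fun P => P.coeff n) hz
    simpa [dvd_iff_isRoot, hc] using hn

lemma IsQuasiPolynomialSpace.exists_isRegular {V : Submodule ℂ (ℂ → ℂ)}
    (hV : IsQuasiPolynomialSpace V) : ∃ L, IsRegular L ∧ entireKer L = V := by
  obtain ⟨ι, _, q, m, hq, rfl⟩ := isQuasiPolynomialSpace_iff_exists_family.1 hV
  obtain ⟨L, hL0, hcard, hdeg, hL⟩ := exists_annihilator Finset.univ q m
  obtain ⟨a, K, ha, rfl, hmonic, hK⟩ := exists_eq_C_mul_of_map_eval_ne_zero hL0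
  have hK0 : K ≠ 0 := right_ne_zero_of_mul hL0
  rw [natDegree_C_mul ha, Finset.card_univ] at hcard
  simp only [entireKer_C_mul ha] at hL
  have hker := eq_entireKer_of_natDegree_le_finrank hK0
    (Submodule.span_le.2 (Set.range_subset_iff.2 fun b => hL b (Finset.mem_univ b)))
    (hq.finrank_span.trans hcard.symm).ge
  refine ⟨K, ⟨?_, hmonic, fun n => ?_, hK⟩, hker.symm⟩
  · rw [← hker, hq.finrank_span, hcard]
  · rcases eq_or_ne (K.coeff n) 0 with hn | hn
    · simp [hn]
    · have := hdeg n
      rw [coeff_C_mul, natDegree_mul ha hn, Polynomial.leadingCoeff_mul, leadingCoeff_C,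
        natDegree_mul ha hmonic.ne_zero] at this
      omega

lemma linearIndependent_of_analyticOrderAt_injective {ι : Type*} {z : ℂ} {f : ι → ℂ → ℂ}
    {e : ι → ℕ} (hf : ∀ i, Differentiable ℂ (f i)) (he : ∀ i, analyticOrderAt (f i) z = e i)
    (hinj : Function.Injective e) : LinearIndependent ℂ f := by
  classical
  rw [linearIndependent_iff']
  intro s c h i hi
  by_contra hci
  obtain ⟨j, hj, hmin⟩ := (s.filter fun i => c i ≠ 0).exists_min_image e
    ⟨i, Finset.mem_filter.2 ⟨hi, hci⟩⟩
  rw [Finset.mem_filter] at hj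
  have hsum : iteratedDeriv (e j) (∑ i ∈ s, c i • f i) z = 0 := by
    rw [h]
    simp
  rw [iteratedDeriv_sum fun i _ => ((hf i).const_smul (c i)).contDiff.contDiffAt,
    Finset.sum_eq_single_of_mem j hj.1] at hsum
  · rw [iteratedDeriv_const_smul_field, smul_eq_mul] at hsum
    exact iteratedDeriv_analyticOrderAt_ne_zero (hf j) (he j)
      ((mul_eq_zero.1 hsum).resolve_left hj.2)
  · intro k hk hkj
    rw [iteratedDeriv_const_smul_field, smul_eq_mul]
    by_cases hck : c k = 0
    · rw [hck, zero_mul]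
    · have hle := hmin k (Finset.mem_filter.2 ⟨hk, hck⟩)
      rw [iteratedDeriv_eq_zero_of_lt_analyticOrderAt (hf k) (he k)
        (lt_of_le_of_ne hle fun h => hkj (hinj h.symm)), mul_zero]

/-- The elements of the basis `b` of `V` have pairwise distinct orders `e j` at `z`, which are then
all the orders at `z` of nonzero elements of `V`. -/
structure IsAdapted {V : Submodule ℂ (ℂ → ℂ)} {N : ℕ} (b : Module.Basis (Fin N) ℂ V) (z : ℂ)
    (e : Fin N → ℕ) : Prop where
  injective : Function.Injective e
  order_eq : ∀ j, analyticOrderAt (b j : ℂ → ℂ) z = e j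
  mem_range : ∀ f ∈ V, ∀ n : ℕ, analyticOrderAt f z = n → n ∈ Set.range e

lemma exists_isAdapted {V : Submodule ℂ (ℂ → ℂ)} (hV : V ≤ entire) [FiniteDimensional ℂ V]
    {N : ℕ} (hN : Module.finrank ℂ V = N) (z : ℂ) :
    ∃ (b : Module.Basis (Fin N) ℂ V) (e : Fin N → ℕ), IsAdapted b z e := by
  let E : Set ℕ := {n | ∃ f ∈ V, analyticOrderAt f z = n}
  choose f hfV hf using fun n : E => n.2
  have hli : LinearIndependent ℂ (fun n : E => (⟨f n, hfV n⟩ : V)) :=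
    LinearIndependent.of_comp V.subtype <|
      linearIndependent_of_analyticOrderAt_injective (fun n => hV (hfV n)) hf
        Subtype.val_injective
  have hfin : Finite E := hli.finite
  have := Fintype.ofFinite E
  have hinj : Function.Injective (jet hV z fun n : E => (n : ℕ)) :=
    jet_injective hV fun g hg n hn => ⟨⟨n, g, hg, hn⟩, rfl⟩
  have hcard : Fintype.card E = N := by
    refine le_antisymm (hN ▸ hli.fintype_card_le_finrank) ?_
    simpa [hN] using LinearMap.finrank_le_finrank_of_injective hinj
  let b₀ := basisOfLinearIndependentOfCardEqFinrank' _ hli (hcard.trans hN.symm)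
  let ε : E ≃ Fin N := Fintype.equivFinOfCardEq hcard
  refine ⟨b₀.reindex ε, fun j => (ε.symm j : ℕ), Subtype.val_injective.comp ε.symm.injective,
    fun j => ?_, fun g hg n hn => ⟨ε ⟨n, g, hg, hn⟩, by simp⟩⟩
  simpa only [Module.Basis.reindex_apply, b₀, coe_basisOfLinearIndependentOfCardEqFinrank']
    using hf _

lemma exponents_eq {V : Submodule ℂ (ℂ → ℂ)} (hV : V ≤ entire) {N : ℕ} {z : ℂ}
    {b : Module.Basis (Fin N) ℂ V} {e : Fin N → ℕ} (hb : IsAdapted b z e) :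
    exponents V z = Nat.cast '' Set.range e := by
  ext n
  constructor
  · rintro ⟨f, hf, hn⟩
    rw [(Differentiable.analyticAt (hV hf) z).meromorphicOrderAt_eq] at hn
    cases ho : analyticOrderAt f z with
    | top => simp [ho] at hn
    | coe k =>
      rw [ho] at hn
      exact ⟨k, hb.mem_range f hf k ho, WithTop.coe_inj.1 hn⟩
  · rintro ⟨_, ⟨j, rfl⟩, rfl⟩
    refine ⟨b j, (b j).2, ?_⟩
    rw [(Differentiable.analyticAt (hV (b j).2) z).meromorphicOrderAt_eq, hb.order_eq j]
    rfl

lemma mem_singularPoints_iff_range_ne {V : Submodule ℂ (ℂ → ℂ)} (hV : V ≤ entire) {N : ℕ} {z : ℂ}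
    {b : Module.Basis (Fin N) ℂ V} {e : Fin N → ℕ} (hb : IsAdapted b z e) :
    z ∈ singularPoints V ↔ Set.range e ≠ Set.Ico 0 N := by
  have hIco : Set.Ico (0 : ℤ) N = Nat.cast '' Set.Ico 0 N := (Nat.image_cast_int_Ico 0 N).symm
  rw [singularPoints, Set.mem_ofPred_eq, exponents_eq hV hb, Module.finrank_eq_card_basis b,
    Fintype.card_fin, hIco, ne_eq, Nat.cast_injective.image_injective.eq_iff]

section localExponents

variable {L : ℂ[X][X]} {z : ℂ}

/-- The order at `z` of the operator `L`: the largest `p` for which the coefficient of `∂^p` does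
not vanish at `z`. -/
def localOrder (L : ℂ[X][X]) (z : ℂ) : ℕ := (L.map (evalRingHom z)).natDegree

lemma analyticOrderAt_ne_localOrder (hz : L.map (evalRingHom z) ≠ 0) {f : ℂ → ℂ}
    (hf : f ∈ entireKer L) : analyticOrderAt f z ≠ localOrder L z := by
  intro he
  have hlt : ∀ p, localOrder L z < p → (L.coeff p).eval z = 0 := fun p hp => by
    simpa using coeff_eq_zero_of_natDegree_lt hp
  have h := hf.2 z
  rw [diffOp_eq_sum_range L f L.natDegree.lt_succ_self, Finset.sum_eq_single (localOrder L z)]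
    at h
  · refine mul_ne_zero ?_ (iteratedDeriv_analyticOrderAt_ne_zero hf.1 he) h
    rw [← coe_evalRingHom, ← coeff_map]
    exact leadingCoeff_ne_zero.2 hz
  · intro p _ hp
    rcases hp.lt_or_gt with hp | hp
    · rw [iteratedDeriv_eq_zero_of_lt_analyticOrderAt hf.1 he hp, mul_zero]
    · rw [hlt p hp, zero_mul]
  · exact fun hN => absurd (Finset.mem_range_succ_iff.2 natDegree_map_le) hN

variable (z) in
lemma exists_scaleRoots_eq (hL : L ≠ 0) :
    ∃ (k : ℕ) (E : ℂ[X][X]), L.scaleRoots (X - C z) = C ((X - C z) ^ k) * E ∧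
      E.map (evalRingHom z) ≠ 0 := by
  have hunit : ¬ IsUnit (C (X - C z) : ℂ[X][X]) := fun h =>
    not_isUnit_X_sub_C z (isUnit_C.1 h)
  obtain ⟨E, hE, hdvd⟩ := (FiniteMultiplicity.of_not_isUnit hunit
    ((scaleRoots_ne_zero hL (X - C z)))).exists_eq_pow_mul_and_not_dvd
  refine ⟨_, E, by rw [C_pow]; exact hE, fun h => hdvd ((C_dvd_iff_dvd_coeff _ _).2 fun n => ?_)⟩
  have hn := congrArg (fun P => P.coeff n) h
  simpa [dvd_iff_isRoot] using hn

lemma isRoot_of_mul_pow_eq {a b : ℂ[X]} {i k : ℕ} (hk : k < i)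
    (h : a * (X - C z) ^ i = b * (X - C z) ^ k) : b.IsRoot z := by
  obtain ⟨d, rfl⟩ := Nat.exists_eq_add_of_lt hk
  have hb : a * (X - C z) ^ (d + 1) = b :=
    mul_right_cancel₀ (pow_ne_zero k (X_sub_C_ne_zero z)) (by rw [← h]; ring)
  simp [← hb]

section indicialRoots

variable {k : ℕ} {E : ℂ[X][X]} (hE : L.scaleRoots (X - C z) = C ((X - C z) ^ k) * E)
  (hE0 : E.map (evalRingHom z) ≠ 0) {e : Fin L.natDegree → ℕ} (he : Function.Injective e)
  (hroot : ∀ j, (indicial (E.map (evalRingHom z))).eval (e j : ℂ) = 0)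
include hE hE0 he hroot

lemma rootMultiplicity_leadingCoeff_eq : L.leadingCoeff.rootMultiplicity z = k := by
  have hdeg : (E.map (evalRingHom z)).natDegree = L.natDegree := by
    refine le_antisymm (natDegree_map_le.trans
      (natDegree_eq_of_scaleRoots_eq (pow_ne_zero k (X_sub_C_ne_zero z)) hE).le)
      (le_trans ?_ (natDegree_indicial_le _))
    by_contra! hlt
    exact indicial_ne_zero hE0 (eq_zero_of_natDegree_lt_card_of_eval_eq_zero _
      (Nat.cast_injective.comp he) hroot (by simpa using hlt))
  have htop : ¬ (E.coeff L.natDegree).IsRoot z := by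
    rw [IsRoot, ← coe_evalRingHom, ← coeff_map, ← hdeg]
    exact leadingCoeff_ne_zero.2 hE0
  have hlead := coeff_mul_pow_eq_of_scaleRoots_eq hE L.natDegree
  rw [Nat.sub_self, pow_zero, mul_one] at hlead
  rw [Polynomial.leadingCoeff, hlead, rootMultiplicity_mul_X_sub_C_pow,
    rootMultiplicity_eq_zero htop, zero_add]
  exact fun h => htop (by simp [h])

lemma mem_range_of_lt_natDegree_sub {n : ℕ} (hn : n < L.natDegree - k) : n ∈ Set.range e := by
  have heval : (indicial (E.map (evalRingHom z))).eval (n : ℂ) = 0 := by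
    rw [eval_indicial (Nat.lt_succ_self _)]
    refine Finset.sum_eq_zero fun p _ => ?_
    rcases lt_or_ge n p with hp | hp
    · rw [descPochhammer_eval_eq_descFactorial, Nat.descFactorial_of_lt hp, Nat.cast_zero,
        mul_zero]
    · rw [coeff_map, coe_evalRingHom, (isRoot_of_mul_pow_eq (by omega)
        (coeff_mul_pow_eq_of_scaleRoots_eq hE p)).eq_zero, zero_mul]
  by_contra hne
  refine indicial_ne_zero hE0 (eq_zero_of_natDegree_lt_card_of_eval_eq_zero _
    (Nat.cast_injective.comp (Fin.cons_injective_iff.2 ⟨hne, he⟩)) (Fin.cases heval hroot) ?_)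
  rw [Fintype.card_fin, Nat.lt_succ_iff]
  exact (natDegree_indicial_le _).trans (natDegree_map_le.trans
    (natDegree_eq_of_scaleRoots_eq (pow_ne_zero k (X_sub_C_ne_zero z)) hE).le)

end indicialRoots

/-- Comparing `(x - z)^N L = (x - z)^k ∑ E_p(x) (x - z)^p ∂^p` at the top order and at the local
order of `L` at `z` shows that `k` is the multiplicity and `N - k` the local order. -/
lemma rootMultiplicity_add_localOrder_eq_and_mem_range (hz : L.map (evalRingHom z) ≠ 0)
    {e : Fin L.natDegree → ℕ} (he : Function.Injective e)
    (hsol : ∀ j, ∃ f ∈ entireKer L, analyticOrderAt f z = e j) :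
    L.leadingCoeff.rootMultiplicity z + localOrder L z = L.natDegree ∧
      ∀ n < localOrder L z, n ∈ Set.range e := by
  obtain ⟨k, E, hE, hE0⟩ := exists_scaleRoots_eq z (L := L) (fun h => hz (by simp [h]))
  have hroot : ∀ j, (indicial (E.map (evalRingHom z))).eval (e j : ℂ) = 0 := fun j => by
    obtain ⟨f, hf, hfe⟩ := hsol j
    exact indicial_eval_analyticOrderAt_eq_zero hE hf hfe
  have hmult := rootMultiplicity_leadingCoeff_eq hE hE0 he hroot
  have hmem := fun n => mem_range_of_lt_natDegree_sub hE hE0 he hroot (n := n)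
  have hlocal : localOrder L z ≤ L.natDegree := natDegree_map_le
  have hk_le : k ≤ L.natDegree - localOrder L z := not_lt.1 fun h => by
    have hzero := isRoot_of_mul_pow_eq h (coeff_mul_pow_eq_of_scaleRoots_eq hE _).symm
    rw [IsRoot, ← coe_evalRingHom, ← coeff_map] at hzero
    exact leadingCoeff_ne_zero.2 hz hzero
  have hle_k : L.natDegree - k ≤ localOrder L z := not_lt.1 fun h => by
    obtain ⟨j, hj⟩ := hmem _ h
    obtain ⟨f, hf, hfe⟩ := hsol j
    exact analyticOrderAt_ne_localOrder hz hf (hfe.trans (congrArg _ hj))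
  exact ⟨by omega, fun n hn => hmem n (by omega)⟩

end localExponents

namespace IsRegular

variable {L : ℂ[X][X]} {N : ℕ} (hL : IsRegular L) {b : Module.Basis (Fin N) ℂ (entireKer L)}
  {z : ℂ} {e : Fin N → ℕ} (hb : IsAdapted b z e)
include hL

include b in
lemma natDegree_eq_of_basis : L.natDegree = N := by
  rw [← hL.finrank_entireKer, Module.finrank_eq_card_basis b, Fintype.card_fin]

include hb

lemma rootMultiplicity_add_localOrder :
    L.leadingCoeff.rootMultiplicity z + localOrder L z = N := by
  obtain rfl := hL.natDegree_eq_of_basis (b := b)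
  exact (rootMultiplicity_add_localOrder_eq_and_mem_range (hL.map_eval_ne_zero z) hb.injective
    fun j => ⟨b j, (b j).2, hb.order_eq j⟩).1

lemma mem_range_of_lt_localOrder {n : ℕ} (hn : n < localOrder L z) : n ∈ Set.range e := by
  obtain rfl := hL.natDegree_eq_of_basis (b := b)
  exact (rootMultiplicity_add_localOrder_eq_and_mem_range (hL.map_eval_ne_zero z) hb.injective
    fun j => ⟨b j, (b j).2, hb.order_eq j⟩).2 n hn

lemma localOrder_notMem_range : localOrder L z ∉ Set.range e := by
  rintro ⟨j, hj⟩
  exact analyticOrderAt_ne_localOrder (hL.map_eval_ne_zero z) (b j).2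
    ((hb.order_eq j).trans (congrArg _ hj))

omit hb in
lemma mem_singularPoints_iff : z ∈ singularPoints (entireKer L) ↔ L.leadingCoeff.IsRoot z := by
  have := hL.finiteDimensional
  obtain ⟨b, e, hb⟩ := exists_isAdapted (entireKer_le_entire L) hL.finrank_entireKer z
  have hmult := hL.rootMultiplicity_add_localOrder hb
  have hs := hL.localOrder_notMem_range hb
  rw [← rootMultiplicity_pos hL.monic_leadingCoeff.ne_zero,
    mem_singularPoints_iff_range_ne (entireKer_le_entire L) hb]
  refine ⟨fun hne => Nat.pos_of_ne_zero fun h0 => hne ?_, fun hpos heq => hs ?_⟩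
  · have hsub : Set.Ico 0 L.natDegree ⊆ Set.range e := fun n hn =>
      hL.mem_range_of_lt_localOrder hb (by rw [Set.mem_Ico] at hn; omega)
    refine (Set.eq_of_subset_of_ncard_le hsub ?_).symm
    simp [Set.ncard_eq_toFinset_card', Set.toFinset_range,
      Finset.card_image_of_injective _ hb.injective]
  · rw [heq, Set.mem_Ico]
    omega

end IsRegular

section det

variable {n : ℕ} {M : ℂ → Matrix (Fin n) (Fin n) ℂ} {x : ℂ}
  (hM : ∀ i j, AnalyticAt ℂ (fun y => M y i j) x)
include hM

lemma analyticAt_det : AnalyticAt ℂ (fun y => (M y).det) x := by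
  simp only [Matrix.det_apply']
  exact Finset.analyticAt_fun_sum _ fun σ _ =>
    analyticAt_const.mul (Finset.analyticAt_fun_prod _ fun i _ => hM _ _)

lemma analyticAt_inv_apply (h0 : (M x).det ≠ 0) (i j : Fin n) :
    AnalyticAt ℂ (fun y => (M y)⁻¹ i j) x := by
  have hadj : AnalyticAt ℂ (fun y => (M y).adjugate i j) x := by
    simp only [Matrix.adjugate_apply]
    refine analyticAt_det fun a c => ?_
    rcases eq_or_ne a j with rfl | ha
    · simpa only [Matrix.updateRow_self] using analyticAt_const
    · simpa only [Matrix.updateRow_ne ha] using hM a c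
  simp only [Matrix.inv_def, Ring.inverse_eq_inv', Matrix.smul_apply, smul_eq_mul]
  exact ((analyticAt_det hM).inv h0).mul hadj

end det

/-- Both sides are the determinant of `B F`, where the rows of `B` are those of `A` and the last row
of `F⁻¹`. -/
lemma det_mul_submatrix_castSucc {n : ℕ} (A : Matrix (Fin n) (Fin (n + 1)) ℂ)
    {F : Matrix (Fin (n + 1)) (Fin (n + 1)) ℂ} (hF : F.det ≠ 0) :
    ((A * F).submatrix id Fin.castSucc).det =
      (∑ j : Fin (n + 1), (-1) ^ (n + (j : ℕ)) * F⁻¹ (Fin.last n) j *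
        (A.submatrix id j.succAbove).det) * F.det := by
  let B : Matrix (Fin (n + 1)) (Fin (n + 1)) ℂ :=
    Matrix.of (Fin.snoc (α := fun _ => Fin (n + 1) → ℂ) A (F⁻¹ (Fin.last n)))
  have hinit : ∀ a, B (Fin.castSucc a) = A a := fun a =>
    Fin.snoc_castSucc (α := fun _ => Fin (n + 1) → ℂ) ..
  have hlast : B (Fin.last n) = F⁻¹ (Fin.last n) :=
    Fin.snoc_last (α := fun _ => Fin (n + 1) → ℂ) ..
  have hBF : ∀ j, (B * F) (Fin.last n) j = (1 : Matrix _ _ ℂ) (Fin.last n) j := fun j => by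
    rw [← Matrix.nonsing_inv_mul F hF.isUnit, Matrix.mul_apply, Matrix.mul_apply, hlast]
  trans (B * F).det
  · rw [Matrix.det_succ_row _ (Fin.last n), Finset.sum_eq_single_of_mem (Fin.last n)
      (Finset.mem_univ _), hBF, Matrix.one_apply_eq, Even.neg_one_pow ⟨_, rfl⟩, one_mul, one_mul,
      Fin.succAbove_last]
    · congr 1
      ext a c
      simp [Matrix.mul_apply, hinit]
    · intro j _ hj
      rw [hBF, Matrix.one_apply_ne hj.symm, mul_zero, zero_mul]
  · rw [Matrix.det_mul, Matrix.det_succ_row B (Fin.last n)]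
    congr 1
    refine Finset.sum_congr rfl fun j _ => ?_
    rw [hlast, Fin.val_last]
    congr 2
    ext a c
    simp [hinit]

/-- The matrix whose `j`-th row is `f_j, f_j', …, f_j^{(k-1)}`. -/
def wronskianMatrix {m : ℕ} (k : ℕ) (f : Fin m → ℂ → ℂ) (x : ℂ) : Matrix (Fin m) (Fin k) ℂ :=
  Matrix.of fun j i => iteratedDeriv i (f j) x

lemma wronskianMatrix_apply {m k : ℕ} (f : Fin m → ℂ → ℂ) (x : ℂ) (j : Fin m) (i : Fin k) :
    wronskianMatrix k f x j i = iteratedDeriv i (f j) x := rfl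

lemma wronskian_eq_det {k : ℕ} (f : Fin k → ℂ → ℂ) (x : ℂ) :
    wronskian f x = (wronskianMatrix k f x).det := rfl

section wronskian

variable {k : ℕ} {f : Fin k → ℂ → ℂ} (hf : ∀ j, Differentiable ℂ (f j))
include hf

lemma analyticAt_wronskianMatrix (x : ℂ) (j i : Fin k) :
    AnalyticAt ℂ (fun y => wronskianMatrix k f y j i) x :=
  (differentiable_iteratedDeriv (hf j) i).analyticAt x

lemma analyticAt_wronskian (x : ℂ) : AnalyticAt ℂ (wronskian f) x :=
  analyticAt_det (analyticAt_wronskianMatrix hf x)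

variable {z : ℂ} {e : Fin k → ℕ} (he : ∀ j, analyticOrderAt (f j) z = e j)
include he

lemma exists_pow_mul_wronskian_eventuallyEq (hinj : Function.Injective e) :
    ∃ H : ℂ → ℂ, AnalyticAt ℂ H z ∧ H z ≠ 0 ∧ ∀ᶠ x in 𝓝 z,
      (x - z) ^ (∑ i : Fin k, (i : ℕ)) * wronskian f x = (x - z) ^ (∑ j, e j) * H x := by
  choose c hc G hG hGz hGf using fun j => exists_pow_mul_iteratedDeriv_eventuallyEq (hf j) (he j)
  refine ⟨fun x => (Matrix.of fun j i : Fin k => G j i x).det,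
    analyticAt_det fun j i => hG j i, ?_, ?_⟩
  · have hdet := Matrix.det_mul_column c
      (Matrix.of fun j i : Fin k => (descPochhammer ℂ (i : ℕ)).eval (e j : ℂ))
    simp only [Matrix.of_apply] at hdet
    simp only [hGz]
    rw [hdet, ← Matrix.det_eval_matrixOfPolynomials_eq_det_vandermonde (fun j => (e j : ℂ))
      (fun i => descPochhammer ℂ (i : ℕ)) (fun i => descPochhammer_natDegree ℂ _)
      (fun i => monic_descPochhammer ℂ _)]
    exact mul_ne_zero (Finset.prod_ne_zero_iff.2 fun j _ => hc j)
      (Matrix.det_vandermonde_ne_zero_iff.2 (Nat.cast_injective.comp hinj))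
  · have hev : ∀ᶠ x in 𝓝 z, ∀ j i : Fin k,
        (x - z) ^ (i : ℕ) * iteratedDeriv (i : ℕ) (f j) x = (x - z) ^ e j * G j i x := by
      simpa only [Filter.eventually_all] using fun j i : Fin k => hGf j i
    filter_upwards [hev] with x hx
    have hrow := Matrix.det_mul_row (fun i : Fin k => (x - z) ^ (i : ℕ)) (wronskianMatrix k f x)
    have hcol := Matrix.det_mul_column (fun j => (x - z) ^ e j)
      (Matrix.of fun j i : Fin k => G j i x)
    simp only [wronskianMatrix_apply, hx, Finset.prod_pow_eq_pow_sum] at hrow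
    simp only [Matrix.of_apply, Finset.prod_pow_eq_pow_sum] at hcol
    rw [wronskian_eq_det, ← hrow, hcol]

lemma meromorphicOrderAt_wronskian (hinj : Function.Injective e) :
    meromorphicOrderAt (wronskian f) z = ((∑ i, ((e i : ℤ) - (i : ℕ)) : ℤ) : WithTop ℤ) := by
  obtain ⟨H, hH, hHz, hHf⟩ := exists_pow_mul_wronskian_eventuallyEq hf he hinj
  rw [meromorphicOrderAt_eq_int_iff (analyticAt_wronskian hf z).meromorphicAt]
  refine ⟨H, hH, hHz, ?_⟩
  filter_upwards [hHf.filter_mono nhdsWithin_le_nhds, self_mem_nhdsWithin] with x hx hne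
  have hxz : x - z ≠ 0 := sub_ne_zero.2 hne
  rw [Finset.sum_sub_distrib, zpow_sub₀ hxz, ← Nat.cast_sum, ← Nat.cast_sum, zpow_natCast,
    zpow_natCast, smul_eq_mul, div_mul_eq_mul_div, ← hx, mul_div_cancel_left₀ _ (pow_ne_zero _ hxz)]

end wronskian

section basis

variable {V : Submodule ℂ (ℂ → ℂ)} (hV : V ≤ entire) {N : ℕ}

/-- The functions underlying a basis of a space of functions. -/
def basisFun (b : Module.Basis (Fin N) ℂ V) (j : Fin N) : ℂ → ℂ := b j

include hV

lemma differentiable_basisFun (b : Module.Basis (Fin N) ℂ V) (j : Fin N) :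
    Differentiable ℂ (basisFun b j) :=
  hV (b j).2

lemma wronskianMatrix_eq_mul (b : Module.Basis (Fin N) ℂ V) {m : ℕ} (k : ℕ) (g : Fin m → V)
    (x : ℂ) :
    wronskianMatrix k (fun j => (g j : ℂ → ℂ)) x
      = (Matrix.of fun j i => b.repr (g j) i) * wronskianMatrix k (basisFun b) x := by
  ext j i
  have hjet := congrArg (fun v => jet hV x (fun i : Fin k => (i : ℕ)) v i) (b.sum_repr (g j)).symm
  simp only [map_sum, map_smul, Finset.sum_apply, Pi.smul_apply, smul_eq_mul] at hjet
  rw [Matrix.mul_apply]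
  exact hjet

lemma exists_wronskian_basisFun_eq_mul (b b' : Module.Basis (Fin N) ℂ V) :
    ∃ d : ℂ, d ≠ 0 ∧ ∀ x, wronskian (basisFun b') x = d * wronskian (basisFun b) x := by
  have := b.invertibleToMatrix b'
  refine ⟨(b.toMatrix b').transpose.det, ?_, fun x => ?_⟩
  · rw [Matrix.det_transpose]
    exact (Matrix.isUnit_det_of_invertible (b.toMatrix b')).ne_zero
  · exact (congrArg Matrix.det (wronskianMatrix_eq_mul hV b N b' x)).trans (Matrix.det_mul _ _)

lemma eventually_wronskian_ne_zero [FiniteDimensional ℂ V] (b : Module.Basis (Fin N) ℂ V) (z : ℂ) :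
    ∀ᶠ x in 𝓝[≠] z, wronskian (basisFun b) x ≠ 0 := by
  obtain ⟨b', e, hb⟩ := exists_isAdapted hV
    ((Module.finrank_eq_card_basis b).trans (Fintype.card_fin N)) z
  obtain ⟨d, hd, hdet⟩ := exists_wronskian_basisFun_eq_mul hV b' b
  have horder := meromorphicOrderAt_wronskian (differentiable_basisFun hV b') hb.order_eq
    hb.injective
  filter_upwards [(meromorphicOrderAt_ne_top_iff_eventually_ne_zero
    (analyticAt_wronskian (differentiable_basisFun hV b') z).meromorphicAt).1
    (horder ▸ WithTop.coe_ne_top)] with x hx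
  rw [hdet]
  exact mul_ne_zero hd hx

end basis

section dualFun

variable {V : Submodule ℂ (ℂ → ℂ)} (hV : V ≤ entire) {n : ℕ} (b : Module.Basis (Fin (n + 1)) ℂ V)

/-- The basis of the conjugate space dual to a basis of `V`: the last row of the inverse of the
Wronskian matrix. -/
def dualFun (j : Fin (n + 1)) (x : ℂ) : ℂ :=
  (wronskianMatrix (n + 1) (basisFun b) x)⁻¹ (Fin.last n) j

lemma dualFun_eq (j : Fin (n + 1)) (x : ℂ) :
    dualFun b j x = (-1) ^ (n + (j : ℕ)) *
      (wronskian (fun i => basisFun b (j.succAbove i)) x / wronskian (basisFun b) x) := by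
  have hminor : (wronskianMatrix (n + 1) (basisFun b) x).submatrix j.succAbove
      (Fin.last n).succAbove = wronskianMatrix n (fun i => basisFun b (j.succAbove i)) x := by
    ext a c
    simp [wronskianMatrix_apply]
  rw [dualFun, Matrix.inv_def, Matrix.smul_apply, Matrix.adjugate_fin_succ_eq_det_submatrix, hminor,
    Ring.inverse_eq_inv', wronskian_eq_det, wronskian_eq_det, smul_eq_mul, Fin.val_last]
  ring

include hV

lemma meromorphicAt_dualFun (j : Fin (n + 1)) (z : ℂ) : MeromorphicAt (dualFun b j) z := by
  rw [funext (dualFun_eq b j)]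
  exact (MeromorphicAt.const _ z).mul
    ((analyticAt_wronskian (fun i => differentiable_basisFun hV b _) z).meromorphicAt.div
      (analyticAt_wronskian (differentiable_basisFun hV b) z).meromorphicAt)

variable {b} in
lemma meromorphicOrderAt_dualFun {z : ℂ} {e : Fin (n + 1) → ℕ} (hb : IsAdapted b z e)
    (j : Fin (n + 1)) :
    meromorphicOrderAt (dualFun b j) z = (((n : ℤ) - e j : ℤ) : WithTop ℤ) := by
  have hd := differentiable_basisFun hV b
  have hd' := fun i => hd (j.succAbove i)
  rw [show dualFun b j = (fun _ => (-1) ^ (n + (j : ℕ))) *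
      (wronskian (fun i => basisFun b (j.succAbove i)) / wronskian (basisFun b)) from
      funext (dualFun_eq b j),
    meromorphicOrderAt_mul_of_ne_zero analyticAt_const (pow_ne_zero _ (neg_ne_zero.2 one_ne_zero)),
    meromorphicOrderAt_div (analyticAt_wronskian hd' z).meromorphicAt
      (analyticAt_wronskian hd z).meromorphicAt,
    meromorphicOrderAt_wronskian hd hb.order_eq hb.injective,
    meromorphicOrderAt_wronskian hd' (fun i => hb.order_eq (j.succAbove i))
      (hb.injective.comp Fin.succAbove_right_injective),
    ← WithTop.LinearOrderedAddCommGroup.coe_sub]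
  congr 1
  simp only [Finset.sum_sub_distrib]
  rw [Fin.sum_univ_succAbove (fun i => (e i : ℤ)) j,
    Fin.sum_univ_castSucc (fun i : Fin (n + 1) => ((i : ℕ) : ℤ))]
  simp only [Fin.val_castSucc, Fin.val_last]
  ring

lemma wronskian_div_mem_span_dualFun (b' : Module.Basis (Fin (n + 1)) ℂ V) (g : Fin n → V) :
    (fun x => wronskian (fun j => (g j : ℂ → ℂ)) x / wronskian (basisFun b') x) ∈
      Submodule.span ℂ (Set.range (dualFun b)) := by
  obtain ⟨d, -, hdet⟩ := exists_wronskian_basisFun_eq_mul hV b b'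
  let A : Matrix (Fin n) (Fin (n + 1)) ℂ := Matrix.of fun j i => b.repr (g j) i
  have hexpand : (fun x => wronskian (fun j => (g j : ℂ → ℂ)) x / wronskian (basisFun b') x) =
      ∑ j : Fin (n + 1),
        (d⁻¹ * ((-1) ^ (n + (j : ℕ)) * (A.submatrix id j.succAbove).det)) • dualFun b j := by
    funext x
    rw [Finset.sum_apply, hdet]
    simp only [Pi.smul_apply, smul_eq_mul]
    rcases eq_or_ne (wronskian (basisFun b) x) 0 with h0 | h0
    · simp [dualFun_eq, h0]
    · have hminor : wronskian (fun j => (g j : ℂ → ℂ)) x =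
          ((A * wronskianMatrix (n + 1) (basisFun b) x).submatrix id Fin.castSucc).det := by
        rw [← wronskianMatrix_eq_mul hV b (n + 1) g x]
        rfl
      rw [hminor, det_mul_submatrix_castSucc A (by exact h0), ← wronskian_eq_det,
        mul_div_mul_right _ _ h0, div_eq_inv_mul, Finset.mul_sum]
      exact Finset.sum_congr rfl fun j _ => by rw [dualFun]; ring
  rw [hexpand]
  exact Submodule.sum_mem _ fun j _ =>
    Submodule.smul_mem _ _ (Submodule.subset_span (Set.mem_range_self j))

lemma conjugate_eq_span_dualFun :
    conjugate V = Submodule.span ℂ (Set.range (dualFun b)) := by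
  have hN : Module.finrank ℂ V = n + 1 :=
    (Module.finrank_eq_card_basis b).trans (Fintype.card_fin _)
  rw [conjugate, hN]
  refine le_antisymm (Submodule.span_le.2 ?_) (Submodule.span_le.2 ?_)
  · rintro _ ⟨b', k, hk, f, hf, rfl⟩
    obtain rfl : k = n := Nat.succ_injective hk
    exact wronskian_div_mem_span_dualFun hV b b' fun j => ⟨f j, hf j⟩
  · rintro _ ⟨j, rfl⟩
    rw [funext (dualFun_eq b j)]
    exact Submodule.smul_mem _ ((-1) ^ (n + (j : ℕ)))
      (Submodule.subset_span ⟨b, n, rfl, _, fun i => (b _).2, rfl⟩)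

end dualFun

section monicCoeff

variable {k : ℕ} (f : Fin k → ℂ → ℂ) {x : ℂ}

lemma sum_wronskianOmit_eq_zero (j : Fin k) (x : ℂ) :
    ∑ p : Fin (k + 1), (-1) ^ (p : ℕ) * iteratedDeriv p (f j) x * wronskianOmit f p x = 0 := by
  let T : Matrix (Fin (k + 1)) (Fin (k + 1)) ℂ :=
    Matrix.of (Fin.cons (α := fun _ => Fin (k + 1) → ℂ) (wronskianMatrix (k + 1) f x j)
      (wronskianMatrix (k + 1) f x))
  have hdet : T.det = 0 :=
    Matrix.det_zero_of_row_eq (i := 0) (j := j.succ) (Fin.succ_ne_zero j).symm rfl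
  rw [← hdet, Matrix.det_succ_row_zero]
  rfl

lemma sum_monicCoeff_mul_iteratedDeriv (j : Fin k) (x : ℂ) :
    ∑ p : Fin (k + 1), monicCoeff f p x * iteratedDeriv p (f j) x = 0 := by
  have hsign (p : Fin (k + 1)) : (-1 : ℂ) ^ (k - (p : ℕ)) = (-1) ^ k * (-1) ^ (p : ℕ) := by
    rw [← pow_sub_mul_pow (-1 : ℂ) p.is_le, mul_assoc, ← pow_add, Even.neg_one_pow ⟨_, rfl⟩,
      mul_one]
  trans (-1) ^ k / wronskian f x * ∑ p : Fin (k + 1),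
    (-1) ^ (p : ℕ) * iteratedDeriv p (f j) x * wronskianOmit f p x
  · rw [Finset.mul_sum]
    exact Finset.sum_congr rfl fun p _ => by rw [monicCoeff, hsign]; ring
  · rw [sum_wronskianOmit_eq_zero, mul_zero]

variable {f} (hW : wronskian f x ≠ 0)
include hW

lemma monicCoeff_last : monicCoeff f (Fin.last k) x = 1 := by
  have homit : wronskianOmit f (Fin.last k) x = wronskian f x := by
    simp [wronskianOmit, wronskian]
  simp [monicCoeff, homit, hW]

lemma eq_zero_of_sum_mul_iteratedDeriv_eq_zero {d : Fin (k + 1) → ℂ} (hlast : d (Fin.last k) = 0)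
    (hsum : ∀ j, ∑ p : Fin (k + 1), d p * iteratedDeriv p (f j) x = 0) : d = 0 := by
  have hinit : (fun i : Fin k => d i.castSucc) = 0 := by
    refine Matrix.eq_zero_of_mulVec_eq_zero (M := wronskianMatrix k f x) hW (funext fun j => ?_)
    have hj := hsum j
    rw [Fin.sum_univ_castSucc, hlast, zero_mul, add_zero] at hj
    exact (Finset.sum_congr rfl fun _ _ => mul_comm _ _).trans hj
  exact funext (Fin.lastCases hlast (congrFun hinit))

end monicCoeff

lemma monicCoeff_eq_div {L : ℂ[X][X]} {f : Fin L.natDegree → ℂ → ℂ} {x : ℂ}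
    (hf : ∀ j, diffOp L (f j) x = 0) (hW : wronskian f x ≠ 0) (hx : L.leadingCoeff.eval x ≠ 0)
    (p : Fin (L.natDegree + 1)) :
    monicCoeff f p x = (L.coeff p).eval x / L.leadingCoeff.eval x := by
  rw [← sub_eq_zero]
  refine congrFun (eq_zero_of_sum_mul_iteratedDeriv_eq_zero hW (d := fun p => monicCoeff f p x -
    (L.coeff p).eval x / L.leadingCoeff.eval x) ?_ fun j => ?_) p
  · rw [monicCoeff_last hW, sub_eq_zero, Fin.val_last]
    exact (div_self hx).symm
  · have hfj := hf j
    rw [diffOp_eq_sum_range L _ L.natDegree.lt_succ_self, Finset.sum_range] at hfj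
    simp only [sub_mul, Finset.sum_sub_distrib, sum_monicCoeff_mul_iteratedDeriv,
      div_mul_eq_mul_div, ← Finset.sum_div, hfj, zero_div, sub_zero]

lemma meromorphicOrderAt_eval {p : ℂ[X]} (hp : p ≠ 0) (z : ℂ) :
    meromorphicOrderAt (fun x => p.eval x) z = (p.rootMultiplicity z : ℤ) := by
  obtain ⟨q, hq, hqz⟩ := exists_eq_pow_rootMultiplicity_mul_and_not_dvd p hp z
  rw [meromorphicOrderAt_eq_int_iff (p.differentiable.analyticAt z).meromorphicAt]
  refine ⟨fun x => q.eval x, q.differentiable.analyticAt z, by rwa [dvd_iff_isRoot] at hqz,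
    Filter.Eventually.of_forall fun x => ?_⟩
  conv_lhs => rw [hq]
  simp

lemma eventually_eval_ne_zero {p : ℂ[X]} (hp : p ≠ 0) (z : ℂ) : ∀ᶠ x in 𝓝[≠] z, p.eval x ≠ 0 :=
  (meromorphicOrderAt_ne_top_iff_eventually_ne_zero
    (p.differentiable.analyticAt z).meromorphicAt).1
    (meromorphicOrderAt_eval hp z ▸ WithTop.coe_ne_top)

namespace IsRegular

variable {L : ℂ[X][X]} (hL : IsRegular L)
include hL

lemma meromorphicOrderAt_pow_mul_monicCoeff
    (b : Module.Basis (Fin L.natDegree) ℂ (entireKer L)) (z : ℂ) (k : ℕ)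
    (p : Fin (L.natDegree + 1)) :
    meromorphicOrderAt (fun x => (x - z) ^ k * monicCoeff (basisFun b) p x) z =
      meromorphicOrderAt (fun x => (L.coeff p).eval x) z +
        ((k - L.leadingCoeff.rootMultiplicity z : ℤ) : WithTop ℤ) := by
  have := hL.finiteDimensional
  have hlc := hL.monic_leadingCoeff.ne_zero
  have heq : (fun x => (x - z) ^ k * monicCoeff (basisFun b) p x) =ᶠ[𝓝[≠] z]
      (fun x => (L.coeff p).eval x) *
        ((fun x => ((X - C z) ^ k).eval x) / fun x => L.leadingCoeff.eval x) := by
    filter_upwards [eventually_wronskian_ne_zero (entireKer_le_entire L) b z,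
      eventually_eval_ne_zero hlc z] with x hW hx
    rw [monicCoeff_eq_div (f := basisFun b) (fun j => (b j).2.2 x) hW hx]
    simp only [Pi.mul_apply, Pi.div_apply, eval_pow, eval_sub, eval_X, eval_C]
    ring
  have hmero : ∀ q : ℂ[X], MeromorphicAt (fun x => q.eval x) z := fun q =>
    (q.differentiable.analyticAt z).meromorphicAt
  rw [meromorphicOrderAt_congr heq, meromorphicOrderAt_mul (hmero _) ((hmero _).div (hmero _)),
    meromorphicOrderAt_div (hmero _) (hmero _), meromorphicOrderAt_eval hlc,
    meromorphicOrderAt_eval (pow_ne_zero k (X_sub_C_ne_zero z)), rootMultiplicity_X_sub_C_pow]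
  rfl

lemma exists_eval_coeff_ne_zero (z : ℂ) :
    ∃ p : Fin (L.natDegree + 1), (L.coeff p).eval z ≠ 0 := by
  by_contra! h
  refine hL.map_eval_ne_zero z (Polynomial.ext fun p => ?_)
  rw [coeff_map, coe_evalRingHom, coeff_zero]
  rcases lt_or_ge L.natDegree p with hp | hp
  · rw [coeff_eq_zero_of_natDegree_lt hp, eval_zero]
  · exact h ⟨p, Nat.lt_succ_of_le hp⟩

lemma poleOrder_eq (z : ℂ) : poleOrder (entireKer L) z = L.leadingCoeff.rootMultiplicity z := by
  have := hL.finiteDimensional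
  rw [poleOrder, hL.finrank_entireKer]
  trans sInf (Set.Ici (L.leadingCoeff.rootMultiplicity z))
  · congr 1
    ext k
    refine ⟨fun ⟨b, hb⟩ => ?_, fun hk =>
      ⟨(Module.finBasis ℂ (entireKer L)).reindex (finCongr hL.finrank_entireKer), fun p => ?_⟩⟩
    · obtain ⟨p, hp⟩ := hL.exists_eval_coeff_ne_zero z
      have hp0 : L.coeff p ≠ 0 := fun h => hp (by rw [h, eval_zero])
      have hk := (hb p).trans_eq (hL.meromorphicOrderAt_pow_mul_monicCoeff b z k p)
      rw [meromorphicOrderAt_eval hp0, rootMultiplicity_eq_zero hp, ← WithTop.coe_add] at hk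
      have hk' := WithTop.coe_nonneg.1 hk
      rw [Set.mem_Ici]
      omega
    · rw [Set.mem_Ici] at hk
      refine le_trans (add_nonneg ?_ (WithTop.coe_nonneg.2 (by omega)))
        (hL.meromorphicOrderAt_pow_mul_monicCoeff _ z k p).ge
      exact ((L.coeff p).differentiable.analyticAt z).meromorphicOrderAt_nonneg
  · exact csInf_Ici

lemma leadingCoeff_eq_eval (x : ℂ) : leadingCoeff (entireKer L) x = L.leadingCoeff.eval x := by
  classical
  have hsing : singularPoints (entireKer L) = (L.leadingCoeff.roots.toFinset : Set ℂ) := by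
    ext z
    simp [hL.mem_singularPoints_iff, hL.monic_leadingCoeff.ne_zero]
  have hroots := (IsAlgClosed.splits L.leadingCoeff).natDegree_eq_card_roots.symm
  rw [leadingCoeff, hsing, finprod_mem_coe_finset]
  conv_rhs => rw [← prod_multiset_X_sub_C_of_monic_of_roots_card_eq hL.monic_leadingCoeff hroots,
    prod_multiset_root_eq_finset_root, eval_prod]
  exact Finset.prod_congr rfl fun z _ => by simp [hL.poleOrder_eq]

end IsRegular

section variationOfParameters

variable {V : Submodule ℂ (ℂ → ℂ)} (hV : V ≤ entire) {n : ℕ}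
  (b : Module.Basis (Fin (n + 1)) ℂ V) {g : ℂ → ℂ} {x : ℂ}

/-- The coefficients `c_j` of the method of variation of parameters, determined by
`∑_j c_j b_j^{(i)} = g^{(i)}` for `i = 0, …, n`. -/
def variationCoeff (g : ℂ → ℂ) (j : Fin (n + 1)) (x : ℂ) : ℂ :=
  ∑ i : Fin (n + 1), iteratedDeriv i g x * (wronskianMatrix (n + 1) (basisFun b) x)⁻¹ i j

include hV

lemma exists_iteratedDeriv_eq (hW : wronskian (basisFun b) x ≠ 0) (g : ℂ → ℂ) :
    ∃ v : V, ∀ i ≤ n, iteratedDeriv i (v : ℂ → ℂ) x = iteratedDeriv i g x := by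
  set F := wronskianMatrix (n + 1) (basisFun b) x
  have hsolve : Matrix.vecMul (fun j => variationCoeff b g j x) F =
      fun i : Fin (n + 1) => iteratedDeriv i g x := by
    change Matrix.vecMul (Matrix.vecMul _ F⁻¹) F = _
    rw [Matrix.vecMul_vecMul, Matrix.nonsing_inv_mul F (isUnit_iff_ne_zero.2 hW), Matrix.vecMul_one]
  refine ⟨∑ j, variationCoeff b g j x • b j, fun i hi => ?_⟩
  trans jet hV x (fun i : Fin (n + 1) => (i : ℕ)) (∑ j, variationCoeff b g j x • b j)
    ⟨i, Nat.lt_succ_of_le hi⟩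
  · rfl
  · simp only [map_sum, map_smul, Finset.sum_apply]
    exact congrFun hsolve ⟨i, Nat.lt_succ_of_le hi⟩

lemma variationCoeff_coe (hW : wronskian (basisFun b) x ≠ 0) (v : V) (j : Fin (n + 1)) :
    variationCoeff b v j x = b.repr v j := by
  have hdet : IsUnit (wronskianMatrix (n + 1) (basisFun b) x).det := isUnit_iff_ne_zero.2 hW
  have hrepr : wronskianMatrix (n + 1) (fun _ : Fin 1 => (v : ℂ → ℂ)) x *
      (wronskianMatrix (n + 1) (basisFun b) x)⁻¹ = Matrix.of fun _ => b.repr v := by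
    rw [wronskianMatrix_eq_mul hV b (n + 1) (fun _ : Fin 1 => v) x, Matrix.mul_assoc,
      Matrix.mul_nonsing_inv _ hdet, Matrix.mul_one]
  exact congrFun (congrFun hrepr 0) j

omit hV in
lemma variationCoeff_add {h : ℂ → ℂ} (hg : Differentiable ℂ g) (hh : Differentiable ℂ h)
    (j : Fin (n + 1)) :
    variationCoeff b (g + h) j = variationCoeff b g j + variationCoeff b h j := by
  funext x
  simp only [variationCoeff, Pi.add_apply, ← Finset.sum_add_distrib, ← add_mul,
    iteratedDeriv_add hg.contDiff.contDiffAt hh.contDiff.contDiffAt]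

lemma hasDerivAt_variationCoeff_of_iteratedDeriv_eq_zero (hg : Differentiable ℂ g)
    (hW : wronskian (basisFun b) x ≠ 0) (hx : ∀ i ≤ n, iteratedDeriv i g x = 0)
    (j : Fin (n + 1)) :
    HasDerivAt (variationCoeff b g j) (iteratedDeriv (n + 1) g x * dualFun b j x) x := by
  have hinv : ∀ i : Fin (n + 1), AnalyticAt ℂ
      (fun y => (wronskianMatrix (n + 1) (basisFun b) y)⁻¹ i j) x := fun i =>
    analyticAt_inv_apply (analyticAt_wronskianMatrix (differentiable_basisFun hV b) x) hW i j
  refine (HasDerivAt.fun_sum fun (i : Fin (n + 1)) _ => (hasDerivAt_iteratedDeriv hg i x).mul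
    (hinv i).differentiableAt.hasDerivAt).congr_deriv ?_
  rw [Fin.sum_univ_castSucc, Finset.sum_eq_zero, zero_add, Fin.val_last, hx n le_rfl, zero_mul,
    add_zero, dualFun]
  intro i _
  rw [Fin.val_castSucc, hx i i.2.le, hx (i + 1) i.2, zero_mul, zero_mul, add_zero]

end variationOfParameters

section regDualFun

variable {L : ℂ[X][X]} {n : ℕ} (b : Module.Basis (Fin (n + 1)) ℂ (entireKer L))

/-- The basis of the regularized conjugate space dual to a basis of `entireKer L`. -/
def regDualFun (j : Fin (n + 1)) (x : ℂ) : ℂ := dualFun b j x * (L.leadingCoeff.eval x)⁻¹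

lemma hasDerivAt_variationCoeff (hn : L.natDegree = n + 1) {g : ℂ → ℂ} (hg : Differentiable ℂ g)
    {x : ℂ} (hW : wronskian (basisFun b) x ≠ 0) (hx : L.leadingCoeff.eval x ≠ 0)
    (j : Fin (n + 1)) :
    HasDerivAt (variationCoeff b g j) (diffOp L g x * regDualFun b j x) x := by
  have hV := entireKer_le_entire L
  -- Subtracting the element of the space with the same derivatives at `x` only changes the
  -- coefficients by constants.
  obtain ⟨v, hvg⟩ := exists_iteratedDeriv_eq hV b hW g
  obtain ⟨h, hgh⟩ : ∃ h, g = h + v := ⟨g - v, (sub_add_cancel _ _).symm⟩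
  have hv : Differentiable ℂ (v : ℂ → ℂ) := hV v.2
  have hh : Differentiable ℂ h := by
    rw [← sub_eq_iff_eq_add.2 hgh]
    exact hg.sub hv
  have hjet : ∀ i ≤ n, iteratedDeriv i h x = 0 := fun i hi => by
    have hi := hvg i hi
    rwa [hgh, iteratedDeriv_add hh.contDiff.contDiffAt hv.contDiff.contDiffAt,
      right_eq_add] at hi
  have hdiffOp : diffOp L g x = L.leadingCoeff.eval x * iteratedDeriv (n + 1) h x := by
    rw [hgh, diffOp_add L hh hv, v.2.2, add_zero, diffOp_eq_sum_range L h L.natDegree.lt_succ_self,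
      Finset.sum_range_succ, Finset.sum_eq_zero, zero_add, hn, Polynomial.leadingCoeff, hn]
    intro p hp
    rw [hjet p (by rw [Finset.mem_range] at hp; omega), mul_zero]
  have hcoeff : variationCoeff b g j =ᶠ[𝓝 x] fun y => variationCoeff b h j y + b.repr v j := by
    filter_upwards [(analyticAt_wronskian (differentiable_basisFun hV b)
      x).continuousAt.eventually_ne hW] with y hy
    rw [hgh, variationCoeff_add b hh hv, Pi.add_apply, variationCoeff_coe hV b hy]
  refine (((hasDerivAt_variationCoeff_of_iteratedDeriv_eq_zero hV b hh hW hjet j).add_const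
    _).congr_of_eventuallyEq hcoeff).congr_deriv ?_
  rw [hdiffOp, regDualFun]
  field_simp

end regDualFun

lemma hasDerivAt_intervalIntegral_exp_mul {φ ψ : ℝ → ℂ} (hφ : Continuous φ) (hψ : Continuous ψ)
    (a b : ℝ) (u : ℂ) :
    HasDerivAt (fun u => ∫ θ in a..b, Complex.exp (u * φ θ) * ψ θ)
      (∫ θ in a..b, Complex.exp (u * φ θ) * (φ θ * ψ θ)) u := by
  have hcont : ∀ v, Continuous fun θ => Complex.exp (v * φ θ) * ψ θ := fun v => by fun_prop
  have hcont' : ∀ v, Continuous fun θ => Complex.exp (v * φ θ) * (φ θ * ψ θ) :=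
    fun v => by fun_prop
  have hbound : Continuous fun θ => Real.exp ((‖u‖ + 1) * ‖φ θ‖) * ‖φ θ * ψ θ‖ := by fun_prop
  refine (intervalIntegral.hasDerivAt_integral_of_dominated_loc_of_deriv_le
    (F' := fun u θ => Complex.exp (u * φ θ) * (φ θ * ψ θ)) (Metric.ball_mem_nhds u one_pos)
    (Filter.Eventually.of_forall fun v => (hcont v).aestronglyMeasurable)
    ((hcont u).intervalIntegrable a b) (hcont' u).aestronglyMeasurable
    (Filter.Eventually.of_forall fun θ _ v hv => ?_) (hbound.intervalIntegrable a b)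
    (Filter.Eventually.of_forall fun θ _ v _ => ?_)).2
  · have hnorm : ‖v‖ ≤ ‖u‖ + 1 :=
      (norm_le_norm_add_norm_sub' v u).trans (by gcongr; exact (mem_ball_iff_norm.1 hv).le)
    rw [norm_mul]
    gcongr
    refine (Complex.norm_exp_le_exp_norm _).trans (Real.exp_le_exp.2 ?_)
    rw [norm_mul]
    gcongr
  · simpa only [one_mul, mul_assoc] using
      (((hasDerivAt_id' v).mul_const (φ θ)).cexp.mul_const (ψ θ))

section circleIntegral

variable {z : ℂ} {r : ℝ} (hr : 0 ≤ r) {h : ℂ → ℂ} (hh : ContinuousOn h (Metric.sphere z r))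

include hr hh

lemma hasDerivAt_circleIntegral_exp_mul (u : ℂ) :
    HasDerivAt (fun u => ∮ x in C(z, r), Complex.exp (u * x) * h x)
      (∮ x in C(z, r), Complex.exp (u * x) * (x * h x)) u := by
  have hcont : Continuous fun θ => deriv (circleMap z r) θ * h (circleMap z r θ) := by
    simp only [deriv_circleMap]
    exact ((continuous_circleMap 0 r).mul continuous_const).mul
      (hh.comp_continuous (continuous_circleMap z r) (circleMap_mem_sphere z hr))
  simpa only [circleIntegral, smul_eq_mul, mul_left_comm] using
    hasDerivAt_intervalIntegral_exp_mul (continuous_circleMap z r) hcont 0 (2 * Real.pi) u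

lemma iteratedDeriv_circleIntegral_exp_mul (k : ℕ) (u : ℂ) :
    iteratedDeriv k (fun u => ∮ x in C(z, r), Complex.exp (u * x) * h x) u =
      ∮ x in C(z, r), Complex.exp (u * x) * (x ^ k * h x) := by
  induction k generalizing h with
  | zero => simp only [iteratedDeriv_zero, pow_zero, one_mul]
  | succ k ih =>
    rw [iteratedDeriv_succ', funext fun u => (hasDerivAt_circleIntegral_exp_mul hr hh u).deriv,
      ih (h := fun x => x * h x) (continuousOn_id.fun_mul hh)]
    simp only [pow_succ, mul_assoc]

lemma diffOp_circleIntegral_exp_mul (L : ℂ[X][X]) (u : ℂ) :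
    diffOp L (fun u => ∮ x in C(z, r), Complex.exp (u * x) * h x) u =
      ∮ x in C(z, r), L.evalEval u x * Complex.exp (u * x) * h x := by
  have hint : ∀ p, CircleIntegrable
      (fun x => (L.coeff p).eval u * (Complex.exp (u * x) * (x ^ p * h x))) z r := fun p =>
    ContinuousOn.circleIntegrable hr (by fun_prop)
  simp only [diffOp, sum_def, iteratedDeriv_circleIntegral_exp_mul hr hh]
  simp only [← circleIntegral.integral_const_mul]
  rw [← circleIntegral.integral_fun_sum fun p _ => hint p]
  congr 1
  funext x
  rw [← eval₂_evalRingHom, eval₂_eq_sum, sum_def, Finset.sum_mul, Finset.sum_mul]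
  exact Finset.sum_congr rfl fun p _ => by rw [coe_evalRingHom]; ring

end circleIntegral

section IsIntegralTransform

variable {f f' g g' : ℂ → ℂ} {z : ℂ}

lemma eventually_forall_closedBall {p : ℂ → Prop} (h : ∀ᶠ x in 𝓝 z, p x) :
    ∀ᶠ r : ℝ in 𝓝[>] 0, ∀ x ∈ Metric.closedBall z r, p x :=
  (eventually_closedBall_subset h).filter_mono nhdsWithin_le_nhds

lemma eventually_forall_sphere {p : ℂ → Prop} (h : ∀ᶠ x in 𝓝[≠] z, p x) :
    ∀ᶠ r : ℝ in 𝓝[>] 0, ∀ x ∈ Metric.sphere z r, p x := by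
  filter_upwards [eventually_forall_closedBall (eventually_nhdsWithin_iff.1 h),
    self_mem_nhdsWithin] with r hr hpos x hx
  exact hr x (Metric.sphere_subset_closedBall hx) (Metric.ne_of_mem_sphere hx hpos.ne')

lemma isIntegralTransform_unique (h : IsIntegralTransform f z g)
    (h' : IsIntegralTransform f z g') : g = g' := by
  obtain ⟨r, hr, hr'⟩ := (h.and h').exists
  funext u
  rw [hr, hr']

lemma isIntegralTransform_congr (h : IsIntegralTransform f z g) (hf : f =ᶠ[𝓝[≠] z] f') :
    IsIntegralTransform f' z g := by
  filter_upwards [h, eventually_forall_sphere hf, self_mem_nhdsWithin] with r hr hff hpos u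
  rw [hr]
  exact circleIntegral.integral_congr (Set.mem_Ioi.1 hpos).le fun x hx => by
    simp only [hff x hx]

lemma isIntegralTransform_sum {ι : Type*} [Fintype ι] {f g : ι → ℂ → ℂ}
    (hf : ∀ i, MeromorphicAt (f i) z) (h : ∀ i, IsIntegralTransform (f i) z (g i)) (c : ι → ℂ) :
    IsIntegralTransform (∑ i, c i • f i) z (∑ i, c i • g i) := by
  filter_upwards [Filter.eventually_all.2 fun i =>
    eventually_forall_sphere (hf i).eventually_analyticAt, Filter.eventually_all.2 h,
    self_mem_nhdsWithin] with r hr hg hpos u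
  have hint : ∀ i, CircleIntegrable (fun x => c i * (Complex.exp (u * x) * f i x)) z r := by
    intro i
    have hcont : ContinuousOn (f i) (Metric.sphere z r) := fun x hx =>
      (hr i x hx).continuousAt.continuousWithinAt
    exact ContinuousOn.circleIntegrable (Set.mem_Ioi.1 hpos).le (by fun_prop)
  simp only [Finset.sum_apply, Pi.smul_apply, smul_eq_mul, hg,
    ← circleIntegral.integral_const_mul]
  rw [← circleIntegral.integral_fun_sum fun i _ => hint i]
  congr 1
  funext x
  rw [Finset.mul_sum]
  exact Finset.sum_congr rfl fun i _ => mul_left_comm _ _ _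

lemma isIntegralTransform_zero (hf : MeromorphicAt f z) (ho : 0 ≤ meromorphicOrderAt f z) :
    IsIntegralTransform f z 0 := by
  have han := hf.meromorphicOrderAt_nonneg_iff_analyticAt_toMeromorphicNFAt.1 ho
  refine isIntegralTransform_congr ?_ hf.eq_nhdsNE_toMeromorphicNFAt.symm
  filter_upwards [eventually_forall_closedBall han.eventually_analyticAt,
    self_mem_nhdsWithin] with r hr hpos u
  have hdiff : DifferentiableOn ℂ (fun x => Complex.exp (u * x) * toMeromorphicNFAt f z x)
      (Metric.closedBall z r) := fun x hx => by
    have := (hr x hx).differentiableAt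
    exact DifferentiableAt.differentiableWithinAt (by fun_prop)
  exact (hdiff.diffContOnCl_ball subset_rfl).circleIntegral_eq_zero (Set.mem_Ioi.1 hpos).le |>.symm

/-- The polynomial `q` for which `q(u) e^{zu}` is the integral transform at `z` of
`g(x) / (x - z)^{d + 1}`, for `g` analytic at `z`. -/
def poleTransform (g : ℂ → ℂ) (z : ℂ) (d : ℕ) : ℂ[X] :=
  ∑ k ∈ Finset.range (d + 1), monomial k
    (2 * Real.pi * Complex.I / d.factorial * ((d.choose k : ℂ) * iteratedDeriv (d - k) g z))

lemma natDegree_poleTransform (d : ℕ) (hg : g z ≠ 0) : (poleTransform g z d).natDegree = d := by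
  have hcoeff : (poleTransform g z d).coeff d = 2 * Real.pi * Complex.I / d.factorial * g z := by
    simp [poleTransform, finsetSum_coeff, coeff_monomial]
  refine le_antisymm (natDegree_sum_le_of_forall_le _ _ fun k hk =>
    (natDegree_monomial_le _).trans (Finset.mem_range_succ_iff.1 hk)) (le_natDegree_of_ne_zero ?_)
  rw [hcoeff]
  exact mul_ne_zero (div_ne_zero Complex.two_pi_I_ne_zero
    (Nat.cast_ne_zero.2 d.factorial_ne_zero)) hg

lemma isIntegralTransform_poleTransform (d : ℕ) (hg : AnalyticAt ℂ g z) :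
    IsIntegralTransform (fun x => 1 / (x - z) ^ (d + 1) * g x) z
      (qexp (poleTransform g z d) z) := by
  filter_upwards [eventually_forall_closedBall hg.eventually_analyticAt,
    self_mem_nhdsWithin] with r hr hpos u
  have hdiff : DifferentiableOn ℂ (fun x => Complex.exp (u * x) * g x)
      (Metric.closedBall z r) := fun x hx => by
    have := (hr x hx).differentiableAt
    exact DifferentiableAt.differentiableWithinAt (by fun_prop)
  have hexp : ContDiffAt ℂ d (fun x => Complex.exp (u * x)) z := by fun_prop
  have hcauchy := hdiff.circleIntegral_one_div_sub_center_pow_smul hpos d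
  rw [iteratedDeriv_fun_mul hexp hg.contDiffAt] at hcauchy
  simp only [smul_eq_mul, mul_left_comm (1 / _ : ℂ)] at hcauchy
  rw [hcauchy]
  simp only [iteratedDeriv_cexp_const_mul, qexp, poleTransform, eval_finsetSum, eval_monomial,
    Finset.mul_sum, Finset.sum_mul]
  refine Finset.sum_congr rfl fun k _ => ?_
  rw [mul_comm z u]
  ring

lemma exists_isIntegralTransform_qexp {d : ℕ} (hf : MeromorphicAt f z)
    (ho : meromorphicOrderAt f z = ((-(d + 1 : ℕ) : ℤ) : WithTop ℤ)) :
    ∃ q : ℂ[X], q.natDegree = d ∧ IsIntegralTransform f z (qexp q z) := by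
  obtain ⟨g, hg, hgz, hfg⟩ := (meromorphicOrderAt_eq_int_iff hf).1 ho
  refine ⟨poleTransform g z d, natDegree_poleTransform d hgz,
    isIntegralTransform_congr (isIntegralTransform_poleTransform d hg) ?_⟩
  filter_upwards [hfg] with x hx
  rw [hx, zpow_neg, zpow_natCast, one_div, smul_eq_mul]

end IsIntegralTransform

section localTransform

/-- The space spanned by the integral transforms around `z` of the elements of `V^†`. -/
def localTransformSpace (V : Submodule ℂ (ℂ → ℂ)) (z : ℂ) : Submodule ℂ (ℂ → ℂ) :=
  Submodule.span ℂ {g | ∃ f ∈ regularizedConjugate V, IsIntegralTransform f z g}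

lemma transformSpace_eq_iSup (V : Submodule ℂ (ℂ → ℂ)) :
    transformSpace V = ⨆ z : singularPoints V, localTransformSpace V z := by
  simp only [transformSpace, localTransformSpace, ← Submodule.span_iUnion]
  congr 1
  ext g
  simp only [Set.mem_ofPred_eq, Set.mem_iUnion, Subtype.exists, exists_prop]

lemma card_subtype_lt_eq_sub {N s : ℕ} {e : Fin N → ℕ} (hinj : Function.Injective e)
    (hmem : ∀ k < s, k ∈ Set.range e) (hs : s ∉ Set.range e) :
    Fintype.card {j // s < e j} = N - s := by
  have himage : (Finset.univ.filter fun j => ¬ s < e j).image e = Finset.range s := by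
    ext k
    simp only [Finset.mem_image, Finset.mem_filter, Finset.mem_univ, true_and, Finset.mem_range]
    constructor
    · rintro ⟨j, hj, rfl⟩
      exact lt_of_le_of_ne (not_lt.1 hj) fun h => hs ⟨j, h⟩
    · intro hk
      obtain ⟨j, rfl⟩ := hmem k hk
      exact ⟨j, hk.asymm, rfl⟩
  have hcompl : (Finset.univ.filter fun j => ¬ s < e j).card = s := by
    rw [← Finset.card_image_of_injective _ hinj, himage, Finset.card_range]
  have hsum := Finset.card_filter_add_card_filter_not (s := (Finset.univ : Finset (Fin N)))
    (fun j => s < e j)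
  rw [Finset.card_univ, Fintype.card_fin, hcompl] at hsum
  rw [Fintype.card_subtype]
  omega

variable {L : ℂ[X][X]} {n : ℕ}

lemma meromorphicAt_regDualFun (b : Module.Basis (Fin (n + 1)) ℂ (entireKer L)) (j : Fin (n + 1))
    (z : ℂ) : MeromorphicAt (regDualFun b j) z :=
  (meromorphicAt_dualFun (entireKer_le_entire L) b j z).mul
    (L.leadingCoeff.differentiable.analyticAt z).meromorphicAt.inv

variable (hL : IsRegular L) {b : Module.Basis (Fin (n + 1)) ℂ (entireKer L)} {z : ℂ}

namespace IsRegular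

include hL

variable (b) in
lemma regularizedConjugate_eq_span_regDualFun :
    regularizedConjugate (entireKer L) = Submodule.span ℂ (Set.range (regDualFun b)) := by
  let mulInv : (ℂ → ℂ) →ₗ[ℂ] (ℂ → ℂ) :=
    LinearMap.mulRight ℂ (fun x => (L.leadingCoeff.eval x)⁻¹)
  have hset : {g | ∃ f ∈ conjugate (entireKer L),
      g = fun x => f x * (leadingCoeff (entireKer L) x)⁻¹} =
      (conjugate (entireKer L)).map mulInv := by
    ext g
    simp only [hL.leadingCoeff_eq_eval, Set.mem_ofPred_eq, SetLike.mem_coe, Submodule.mem_map,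
      eq_comm (a := g)]
    rfl
  rw [regularizedConjugate, hset, Submodule.span_eq,
    conjugate_eq_span_dualFun (entireKer_le_entire L) b, Submodule.map_span, ← Set.range_comp]
  rfl

lemma meromorphicOrderAt_regDualFun {e : Fin (n + 1) → ℕ} (hb : IsAdapted b z e)
    (j : Fin (n + 1)) :
    meromorphicOrderAt (regDualFun b j) z =
      (((localOrder L z : ℤ) - 1 - e j : ℤ) : WithTop ℤ) := by
  have hlc := (L.leadingCoeff.differentiable.analyticAt z).meromorphicAt
  have hmult := hL.rootMultiplicity_add_localOrder hb
  refine (meromorphicOrderAt_mul (meromorphicAt_dualFun (entireKer_le_entire L) b j z)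
    hlc.inv).trans ?_
  rw [meromorphicOrderAt_inv, meromorphicOrderAt_dualFun (entireKer_le_entire L) hb,
    meromorphicOrderAt_eval hL.monic_leadingCoeff.ne_zero,
    ← WithTop.LinearOrderedAddCommGroup.coe_neg, ← WithTop.coe_add]
  congr 1
  omega

lemma diffOp_swap_eq_zero {j : Fin (n + 1)} {g : ℂ → ℂ}
    (hg : IsIntegralTransform (regDualFun b j) z g) (u : ℂ) :
    diffOp (Bivariate.swap L) g u = 0 := by
  have hV := entireKer_le_entire L
  have := hL.finiteDimensional
  obtain ⟨r, hgr, hW, hlc, han, hpos⟩ := (hg.and <|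
    (eventually_forall_sphere (eventually_wronskian_ne_zero hV b z)).and <|
    (eventually_forall_sphere (eventually_eval_ne_zero hL.monic_leadingCoeff.ne_zero z)).and <|
    (eventually_forall_sphere (meromorphicAt_regDualFun b j z).eventually_analyticAt).and
    self_mem_nhdsWithin).exists
  have hr : 0 ≤ r := (Set.mem_Ioi.1 hpos).le
  have hcont : ContinuousOn (regDualFun b j) (Metric.sphere z r) :=
    fun x hx => (han x hx).continuousAt.continuousWithinAt
  have hexp : Differentiable ℂ fun x => Complex.exp (u * x) := by fun_prop
  rw [funext hgr, diffOp_circleIntegral_exp_mul hr hcont]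
  -- By variation of parameters, `(L e^{ux}) w_j` is the derivative of a single-valued function.
  refine circleIntegral.integral_eq_zero_of_hasDerivWithinAt
    (f := variationCoeff b (fun x => Complex.exp (u * x)) j) hr fun x hx =>
      (HasDerivAt.congr_deriv (hasDerivAt_variationCoeff b
        (hL.natDegree_eq_of_basis (b := b)) hexp (hW x hx) (hlc x hx) j) ?_).hasDerivWithinAt
  rw [diffOp_exp, evalEval_swap]

lemma exists_isIntegralTransform_regDualFun {e : Fin (n + 1) → ℕ} (hb : IsAdapted b z e)
    (j : Fin (n + 1)) :
    ∃ q : ℂ[X], IsIntegralTransform (regDualFun b j) z (qexp q z) ∧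
      q.natDegree = e j - localOrder L z ∧ (e j ≤ localOrder L z → q = 0) := by
  have hmero := meromorphicAt_regDualFun b j z
  have hord := hL.meromorphicOrderAt_regDualFun hb j
  have hne : e j ≠ localOrder L z := fun h => hL.localOrder_notMem_range hb ⟨j, h⟩
  rcases hne.lt_or_gt with hlt | hgt
  · refine ⟨0, ?_, by rw [natDegree_zero]; omega, fun _ => rfl⟩
    rw [qexp_eq_zero_iff.2 rfl]
    refine isIntegralTransform_zero hmero ?_
    rw [hord]
    exact WithTop.coe_nonneg.2 (by omega)
  · obtain ⟨q, hq, hqz⟩ := exists_isIntegralTransform_qexp (d := e j - localOrder L z) hmero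
      (by rw [hord]; congr 1; omega)
    exact ⟨q, hqz, hq, fun hle => absurd hle hgt.not_ge⟩

lemma localTransformSpace_eq_span {g : Fin (n + 1) → ℂ → ℂ}
    (hg : ∀ j, IsIntegralTransform (regDualFun b j) z (g j)) :
    localTransformSpace (entireKer L) z = Submodule.span ℂ (Set.range g) := by
  rw [localTransformSpace, hL.regularizedConjugate_eq_span_regDualFun b]
  refine le_antisymm (Submodule.span_le.2 ?_) (Submodule.span_mono ?_)
  · rintro f ⟨w, hw, hwf⟩
    obtain ⟨c, rfl⟩ := (Submodule.mem_span_range_iff_exists_fun ℂ).1 hw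
    refine (Submodule.mem_span_range_iff_exists_fun ℂ).2 ⟨c, isIntegralTransform_unique ?_ hwf⟩
    exact isIntegralTransform_sum (fun j => meromorphicAt_regDualFun b j z) hg c
  · rintro _ ⟨j, rfl⟩
    exact ⟨_, Submodule.subset_span (Set.mem_range_self j), hg j⟩

lemma exists_localTransformSpace_eq_span (hz : L.leadingCoeff.IsRoot z) :
    ∃ (κ : Type) (_ : Fintype κ) (q : κ → ℂ[X]),
      Fintype.card κ = L.leadingCoeff.rootMultiplicity z ∧ (∀ a, 0 < (q a).natDegree) ∧
      Function.Injective (fun a => (q a).natDegree) ∧ (∀ a, qexp (q a) z ∈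
        entireKer (Bivariate.swap L)) ∧ localTransformSpace (entireKer L) z =
        Submodule.span ℂ (Set.range fun a => qexp (q a) z) := by
  have := hL.finiteDimensional
  obtain ⟨n, hn⟩ : ∃ n, L.natDegree = n + 1 := by
    refine Nat.exists_eq_succ_of_ne_zero fun h0 => ?_
    obtain ⟨⟨p, hp⟩, hpz⟩ := hL.exists_eval_coeff_ne_zero z
    obtain rfl : p = L.natDegree := by omega
    exact hpz hz
  obtain ⟨b, e, hb⟩ := exists_isAdapted (entireKer_le_entire L) (hL.finrank_entireKer.trans hn) z
  choose q hqz hdeg hzero using hL.exists_isIntegralTransform_regDualFun hb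
  have hmult := hL.rootMultiplicity_add_localOrder hb
  refine ⟨{j // localOrder L z < e j}, inferInstance, fun j => q j, ?_, fun j => ?_,
    fun i j hij => Subtype.ext (hb.injective ?_), fun j => ⟨qexp_mem_entire _ z,
      hL.diffOp_swap_eq_zero (hqz j)⟩, ?_⟩
  · rw [card_subtype_lt_eq_sub hb.injective (fun k => hL.mem_range_of_lt_localOrder hb)
      (hL.localOrder_notMem_range hb)]
    omega
  · rw [hdeg]
    exact Nat.sub_pos_of_lt j.2
  · simp only [hdeg] at hij
    exact (tsub_left_inj i.2.le j.2.le).1 hij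
  · rw [hL.localTransformSpace_eq_span hqz]
    refine le_antisymm (Submodule.span_le.2 ?_) (Submodule.span_mono ?_)
    · rintro _ ⟨j, rfl⟩
      by_cases hj : localOrder L z < e j
      · exact Submodule.subset_span ⟨⟨j, hj⟩, rfl⟩
      · simp only [hzero j (not_lt.1 hj), qexp_eq_zero_iff.2, SetLike.mem_coe, zero_mem]
    · rintro _ ⟨j, rfl⟩
      exact ⟨j, rfl⟩

end IsRegular

end localTransform

section bispectralDuality

lemma natDegree_coeff_swap_le (L : ℂ[X][X]) (i : ℕ) :
    ((Bivariate.swap L).coeff i).natDegree ≤ L.natDegree := by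
  refine natDegree_le_iff_coeff_eq_zero.2 fun j hj => ?_
  rw [coeff_coeff_swap, coeff_eq_zero_of_natDegree_lt hj, coeff_zero]

namespace IsRegular

variable {L : ℂ[X][X]} (hL : IsRegular L)

include hL

lemma exists_transformSpace_eq_span :
    ∃ (ι : Type) (_ : Fintype ι) (q : ι → ℂ[X]) (m : ι → ℂ), IsQuasiPolynomialFamily q m ∧
      Fintype.card ι = L.leadingCoeff.natDegree ∧
      (∀ a, qexp (q a) (m a) ∈ entireKer (Bivariate.swap L)) ∧
      transformSpace (entireKer L) = Submodule.span ℂ (Set.range fun a => qexp (q a) (m a)) := by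
  have hroot (z : singularPoints (entireKer L)) : L.leadingCoeff.IsRoot z :=
    hL.mem_singularPoints_iff.1 z.2
  have hroots : singularPoints (entireKer L) = L.leadingCoeff.roots.toFinset := by
    ext z
    rw [hL.mem_singularPoints_iff, Finset.mem_coe, Multiset.mem_toFinset,
      mem_roots hL.monic_leadingCoeff.ne_zero]
  let := Fintype.ofFinset (p := singularPoints (entireKer L)) L.leadingCoeff.roots.toFinset
    fun z => by rw [hroots, Finset.mem_coe]
  choose κ hκ q hcard hpos hinj hker hspan using
    fun z => hL.exists_localTransformSpace_eq_span (hroot z)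
  refine ⟨Σ z, κ z, inferInstance, fun a => q a.1 a.2, fun a => a.1, ⟨fun a => hpos a.1 a.2, ?_⟩,
    ?_, fun a => hker a.1 a.2, ?_⟩
  · rintro ⟨z, i⟩ ⟨w, j⟩ h
    obtain ⟨hzw, hij⟩ := Prod.ext_iff.1 h
    obtain rfl : z = w := Subtype.ext hzw
    exact congrArg (Sigma.mk z) (hinj z hij)
  · simp only [Fintype.card_sigma, hcard]
    rw [(IsAlgClosed.splits L.leadingCoeff).natDegree_eq_card_roots,
      ← Multiset.toFinset_sum_count_eq]
    simp only [count_roots]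
    exact (Finset.sum_subtype (p := (· ∈ singularPoints (entireKer L))) _
      (fun z => by rw [hroots, Finset.mem_coe]) fun z => L.leadingCoeff.rootMultiplicity z).symm
  · rw [transformSpace_eq_iSup, Set.range_sigma_eq_iUnion_range, Submodule.span_iUnion]
    exact iSup_congr hspan

lemma isQuasiPolynomialSpace_transformSpace :
    IsQuasiPolynomialSpace (transformSpace (entireKer L)) := by
  obtain ⟨ι, _, q, m, hfam, -, -, hspan⟩ := hL.exists_transformSpace_eq_span
  exact isQuasiPolynomialSpace_iff_exists_family.2 ⟨ι, inferInstance, q, m, hfam, hspan⟩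

lemma finrank_transformSpace :
    Module.finrank ℂ (transformSpace (entireKer L)) = L.leadingCoeff.natDegree := by
  obtain ⟨ι, _, q, m, hfam, hcard, -, hspan⟩ := hL.exists_transformSpace_eq_span
  rw [hspan, hfam.finrank_span, hcard]

lemma transformSpace_le_entireKer_swap :
    transformSpace (entireKer L) ≤ entireKer (Bivariate.swap L) := by
  obtain ⟨ι, _, q, m, -, -, hker, hspan⟩ := hL.exists_transformSpace_eq_span
  rw [hspan, Submodule.span_le]
  rintro _ ⟨a, rfl⟩
  exact hker a

lemma coeff_swap_leadingCoeff_natDegree_coeff :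
    ((Bivariate.swap L).coeff L.leadingCoeff.natDegree).coeff L.natDegree = 1 := by
  rw [coeff_coeff_swap]
  exact hL.monic_leadingCoeff

lemma natDegree_swap : (Bivariate.swap L).natDegree = L.leadingCoeff.natDegree := by
  refine le_antisymm (natDegree_le_iff_coeff_eq_zero.2 fun i hi => ?_)
    (le_natDegree_of_ne_zero fun h => ?_)
  · ext j
    rw [coeff_coeff_swap, coeff_zero]
    exact coeff_eq_zero_of_natDegree_lt ((hL.natDegree_coeff_le j).trans_lt hi)
  · simpa only [h, coeff_zero, zero_ne_one] using hL.coeff_swap_leadingCoeff_natDegree_coeff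

lemma transformSpace_entireKer :
    transformSpace (entireKer L) = entireKer (Bivariate.swap L) :=
  eq_entireKer_of_natDegree_le_finrank
    ((map_ne_zero_iff _ Bivariate.swap.injective).2 hL.ne_zero)
    hL.transformSpace_le_entireKer_swap (hL.natDegree_swap.trans hL.finrank_transformSpace.symm).le

lemma natDegree_leadingCoeff_swap : (Bivariate.swap L).leadingCoeff.natDegree = L.natDegree := by
  refine le_antisymm (natDegree_coeff_swap_le L _) (le_natDegree_of_ne_zero ?_)
  rw [Polynomial.leadingCoeff, hL.natDegree_swap, hL.coeff_swap_leadingCoeff_natDegree_coeff]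
  exact one_ne_zero

lemma swap (hV : IsQuasiPolynomialSpace (entireKer L)) : IsRegular (Bivariate.swap L) where
  finrank_entireKer := by
    rw [← hL.transformSpace_entireKer, hL.finrank_transformSpace, hL.natDegree_swap]
  monic_leadingCoeff := by
    rw [Monic.def, Polynomial.leadingCoeff, hL.natDegree_leadingCoeff_swap,
      Polynomial.leadingCoeff, hL.natDegree_swap, hL.coeff_swap_leadingCoeff_natDegree_coeff]
  natDegree_coeff_le i := hL.natDegree_leadingCoeff_swap ▸ natDegree_coeff_swap_le L i
  map_eval_ne_zero u hu := by
    obtain ⟨ι, _, q, m, hfam, hspan⟩ := isQuasiPolynomialSpace_iff_exists_family.1 hV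
    have hsymbol (x : ℂ) : L.evalEval x u = 0 := by
      rw [← evalEval_swap, ← map_evalRingHom_eval, hu, eval_zero]
    refine hfam.exp_notMem_span u (hspan ▸ ⟨qexp_mem_entire 1 u, fun x => ?_⟩)
    have hexp : qexp 1 u = fun x => Complex.exp (u * x) := by
      funext x
      rw [qexp, eval_one, one_mul]
    rw [hexp, diffOp_exp, hsymbol, zero_mul]

end IsRegular

end bispectralDuality

end Bispectral

end

theorem corollary2p6 (V U : Submodule ℂ (ℂ → ℂ)) (h : Bispectral.IsBispectralDual U V) :
    Bispectral.IsBispectralDual V U := by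
  obtain ⟨hV, rfl⟩ := h
  obtain ⟨L, hL, rfl⟩ := hV.exists_isRegular
  refine ⟨hL.isQuasiPolynomialSpace_transformSpace, ?_⟩
  rw [hL.transformSpace_entireKer, (hL.swap hV).transformSpace_entireKer,
    Polynomial.Bivariate.swap_swap_apply]
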